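/- Let $H$ be a separable complex Hilbert space, and let $\mathcal{C}(H)=B(H)/K(H)$ be its Calkin algebra, the quotient C*-algebra of the bounded operators on $H$ by the ideal of compact operators. Then $\mathcal{C}(H)$ is essentially non-factorizable: there are no infinite-dimensional C*-algebras $\mathcal{B}$ and $\mathcal{D}$ (unital or not) and no C*-norm $\nu$ on the algebraic tensor product $\mathcal{B}\odot\mathcal{D}$ over $\mathbb{C}$ such that $\mathcal{C}(H)$ is $*$-isomorphic to the completion $\mathcal{B}\otimes_\nu\mathcal{D}$ of $\mathcal{B}\odot\mathcal{D}$ with respect to $\nu$. (A C*-norm on a complex $*$-algebra is a submultiplicative norm satisfying $\nu(x^*x)=\nu(x)^2$.) -/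

import Mathlib

open scoped TensorProduct

universe u v w

noncomputable section

/-! ### C⋆-norms and completions -/

/-- A C⋆-norm on a complex ⋆-algebra `A`: a norm which is submultiplicative and satisfies the
C⋆-identity `‖a⋆ a‖ = ‖a‖²`. -/
structure CStarNorm (A : Type*) [NonUnitalRing A] [StarRing A] [Module ℂ A] extends
    Seminorm ℂ A where
  eq_zero_of_map_eq_zero' : ∀ a, toFun a = 0 → a = 0
  mul_le' : ∀ a b, toFun (a * b) ≤ toFun a * toFun b
  star_mul_self' : ∀ a, toFun (star a * a) = toFun a ^ 2

/-- The ⋆-algebra `A`, regarded as a normed ⋆-algebra through the C⋆-norm `ν`. -/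
def WithCStarNorm {A : Type*} [NonUnitalRing A] [StarRing A] [Module ℂ A] (_ν : CStarNorm A) :
    Type _ := A

namespace WithCStarNorm

variable {A : Type*} [NonUnitalRing A] [StarRing A] [Module ℂ A] (ν : CStarNorm A)

instance : NonUnitalRing (WithCStarNorm ν) := inferInstanceAs (NonUnitalRing A)

instance : StarRing (WithCStarNorm ν) := inferInstanceAs (StarRing A)

instance : Module ℂ (WithCStarNorm ν) := inferInstanceAs (Module ℂ A)

instance [IsScalarTower ℂ A A] : IsScalarTower ℂ (WithCStarNorm ν) (WithCStarNorm ν) :=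
  inferInstanceAs (IsScalarTower ℂ A A)

instance [SMulCommClass ℂ A A] : SMulCommClass ℂ (WithCStarNorm ν) (WithCStarNorm ν) :=
  inferInstanceAs (SMulCommClass ℂ A A)

instance [StarModule ℂ A] : StarModule ℂ (WithCStarNorm ν) :=
  inferInstanceAs (StarModule ℂ A)

instance : NormedAddCommGroup (WithCStarNorm ν) :=
  AddGroupNorm.toNormedAddCommGroup (E := WithCStarNorm ν)
    { toFun := fun a => ν.toSeminorm a
      map_zero' := map_zero ν.toSeminorm
      add_le' := map_add_le_add ν.toSeminorm
      neg' := map_neg_eq_map ν.toSeminorm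
      eq_zero_of_map_eq_zero' := ν.eq_zero_of_map_eq_zero' }

theorem norm_def (a : WithCStarNorm ν) : ‖a‖ = ν.toSeminorm a := rfl

instance : NonUnitalNormedRing (WithCStarNorm ν) where
  dist_eq := NormedAddCommGroup.dist_eq
  norm_mul_le := ν.mul_le'

instance : NormedSpace ℂ (WithCStarNorm ν) where
  norm_smul_le c a := (map_smul_eq_mul ν.toSeminorm c a).le

instance : CStarRing (WithCStarNorm ν) where
  norm_mul_self_le a := by
    have h := ν.star_mul_self' a
    rw [sq] at h
    exact h.ge

end WithCStarNorm

/-- The completion of a normed ⋆-algebra. -/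
def CStarCompletion (A : Type*) [NonUnitalNormedRing A] : Type _ := UniformSpace.Completion A

namespace CStarCompletion

open UniformSpace Function

variable {A : Type*} [NonUnitalNormedRing A]

instance : NormedAddCommGroup (CStarCompletion A) :=
  inferInstanceAs (NormedAddCommGroup (Completion A))

instance : CompleteSpace (CStarCompletion A) :=
  inferInstanceAs (CompleteSpace (Completion A))

/-- The canonical map of `A` into its completion. -/
def of (a : A) : CStarCompletion A := ((a : Completion A) : Completion A)

theorem isDenseInducing_of : IsDenseInducing (of : A → CStarCompletion A) :=
  Completion.isDenseInducing_coe

theorem continuous_of : Continuous (of : A → CStarCompletion A) := isDenseInducing_of.continuous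

theorem of_add (a b : A) : of (a + b) = of a + of b := Completion.coe_add a b

theorem of_zero : of (0 : A) = 0 := rfl

theorem norm_of (a : A) : ‖of a‖ = ‖a‖ := Completion.norm_coe a

theorem induction_on {p : CStarCompletion A → Prop} (x : CStarCompletion A)
    (hp : IsClosed {x | p x}) (h : ∀ a : A, p (of a)) : p x :=
  isClosed_property isDenseInducing_of.dense hp h x

theorem induction_on₂ {p : CStarCompletion A → CStarCompletion A → Prop}
    (x y : CStarCompletion A)
    (hp : IsClosed {x : CStarCompletion A × CStarCompletion A | p x.1 x.2})
    (h : ∀ a b : A, p (of a) (of b)) : p x y :=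
  isClosed_property2 isDenseInducing_of.dense hp h x y

theorem induction_on₃ {p : CStarCompletion A → CStarCompletion A → CStarCompletion A → Prop}
    (x y z : CStarCompletion A)
    (hp : IsClosed {x : CStarCompletion A × CStarCompletion A × CStarCompletion A |
      p x.1 x.2.1 x.2.2})
    (h : ∀ a b c : A, p (of a) (of b) (of c)) : p x y z :=
  isClosed_property3 isDenseInducing_of.dense hp h x y z

/-- The multiplication of the completion: the continuous extension of that of `A`. -/
instance : Mul (CStarCompletion A) :=
  ⟨curry <| (isDenseInducing_of.prodMap isDenseInducing_of).extend (of ∘ uncurry (· * ·))⟩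

theorem of_mul (a b : A) : of (a * b) = of a * of b :=
  ((isDenseInducing_of.prodMap isDenseInducing_of).extend_eq
    (continuous_of.comp (@continuous_mul A _ _ _)) (a, b)).symm

instance : ContinuousMul (CStarCompletion A) where
  continuous_mul := by
    let i : A →+ CStarCompletion A := ⟨⟨of, of_zero⟩, of_add⟩
    let m := (AddMonoidHom.mul : A →+ A →+ A).compr₂ i
    have : Continuous fun p : A × A => m p.1 p.2 := continuous_of.comp continuous_mul
    have di : IsDenseInducing (i : A → CStarCompletion A) := isDenseInducing_of
    exact (di.extend_Z_bilin di this :)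

instance : NonUnitalRing (CStarCompletion A) where
  zero_mul a := induction_on (p := fun a => 0 * a = 0) a
    (isClosed_eq (by fun_prop) continuous_const)
    fun a => by rw [← of_zero, ← of_mul, zero_mul]
  mul_zero a := induction_on (p := fun a => a * 0 = 0) a
    (isClosed_eq (by fun_prop) continuous_const)
    fun a => by rw [← of_zero, ← of_mul, mul_zero]
  mul_assoc a b c := induction_on₃ (p := fun a b c => a * b * c = a * (b * c)) a b c
    (isClosed_eq (by fun_prop) (by fun_prop))
    fun a b c => by simp only [← of_mul, mul_assoc]
  left_distrib a b c := induction_on₃ (p := fun a b c => a * (b + c) = a * b + a * c) a b c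
    (isClosed_eq (by fun_prop) (by fun_prop))
    fun a b c => by simp only [← of_mul, ← of_add, mul_add]
  right_distrib a b c := induction_on₃ (p := fun a b c => (a + b) * c = a * c + b * c) a b c
    (isClosed_eq (by fun_prop) (by fun_prop))
    fun a b c => by simp only [← of_mul, ← of_add, add_mul]

instance : NonUnitalNormedRing (CStarCompletion A) where
  dist_eq := NormedAddCommGroup.dist_eq
  norm_mul_le a b := induction_on₂ (p := fun a b => ‖a * b‖ ≤ ‖a‖ * ‖b‖) a b
    (isClosed_le (by fun_prop) (by fun_prop))
    fun a b => by simpa only [← of_mul, norm_of] using norm_mul_le a b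

instance [NormedSpace ℂ A] : Module ℂ (CStarCompletion A) :=
  inferInstanceAs (Module ℂ (Completion A))

instance [NormedSpace ℂ A] : NormedSpace ℂ (CStarCompletion A) where
  norm_smul_le := norm_smul_le (α := ℂ) (β := Completion A)

theorem of_smul [NormedSpace ℂ A] (c : ℂ) (a : A) : of (c • a) = c • of a :=
  Completion.coe_smul c a

variable [StarRing A]

/-- The involution of the completion: the continuous extension of that of `A`. -/
instance : Star (CStarCompletion A) := ⟨(Completion.map (star : A → A) :)⟩

theorem continuous_star_completion :
    Continuous (star : CStarCompletion A → CStarCompletion A) :=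
  Completion.continuous_map (f := (star : A → A))

variable [CStarRing A]

theorem of_star (a : A) : of (star a) = star (of a) :=
  (Completion.map_coe star_isometry.uniformContinuous a).symm

instance : StarRing (CStarCompletion A) where
  star_involutive a := induction_on (p := fun a => star (star a) = a) a
    (isClosed_eq (continuous_star_completion.comp continuous_star_completion) continuous_id)
    fun a => by simp only [← of_star, star_star]
  star_mul a b := induction_on₂ (p := fun a b => star (a * b) = star b * star a) a b
    (isClosed_eq (continuous_star_completion.comp continuous_mul)
      ((continuous_star_completion.comp continuous_snd).mul
        (continuous_star_completion.comp continuous_fst)))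
    fun a b => by simp only [← of_star, ← of_mul, star_mul]
  star_add a b := induction_on₂ (p := fun a b => star (a + b) = star a + star b) a b
    (isClosed_eq (continuous_star_completion.comp continuous_add)
      ((continuous_star_completion.comp continuous_fst).add
        (continuous_star_completion.comp continuous_snd)))
    fun a b => by simp only [← of_star, ← of_add, star_add]

instance : CStarRing (CStarCompletion A) where
  norm_mul_self_le a := induction_on (p := fun a => ‖a‖ * ‖a‖ ≤ ‖star a * a‖) a
    (isClosed_le (by fun_prop) ((continuous_star_completion.mul continuous_id).norm))
    fun a => by
      simpa only [← of_star, ← of_mul, norm_of] using CStarRing.norm_mul_self_le a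

instance [NormedSpace ℂ A] [IsScalarTower ℂ A A] :
    IsScalarTower ℂ (CStarCompletion A) (CStarCompletion A) where
  smul_assoc c a b := induction_on₂ (p := fun a b => (c • a) * b = c • (a * b)) a b
    (isClosed_eq ((continuous_fst.const_smul c).mul continuous_snd)
      (continuous_mul.const_smul c))
    fun a b => by rw [← of_smul, ← of_mul, ← of_mul, ← of_smul, smul_mul_assoc]

instance [NormedSpace ℂ A] [SMulCommClass ℂ A A] :
    SMulCommClass ℂ (CStarCompletion A) (CStarCompletion A) where
  smul_comm c a b := induction_on₂ (p := fun a b => c • (a * b) = a * (c • b)) a b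
    (isClosed_eq (continuous_mul.const_smul c)
      (continuous_fst.mul (continuous_snd.const_smul c)))
    fun a b => by rw [← of_smul, ← of_mul, ← of_mul, ← of_smul, mul_smul_comm]

instance [NormedSpace ℂ A] [StarModule ℂ A] : StarModule ℂ (CStarCompletion A) where
  star_smul c a := induction_on (p := fun a => star (c • a) = star c • star a) a
    (isClosed_eq (continuous_star_completion.comp (continuous_const_smul c))
      (continuous_star_completion.const_smul (star c)))
    fun a => by rw [← of_smul, ← of_star, ← of_star, ← of_smul, star_smul]

/-- The completion of a ⋆-algebra under a C⋆-norm is a C⋆-algebra. -/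
instance [NormedSpace ℂ A] [IsScalarTower ℂ A A] [SMulCommClass ℂ A A] [StarModule ℂ A] :
    NonUnitalCStarAlgebra (CStarCompletion A) where

end CStarCompletion

/-- `B ⊗_ν C`: the completion of the algebraic tensor product `B ⊙ C` of two C⋆-algebras under a
C⋆-norm `ν` on it. -/
abbrev CStarTensorProduct {B C : Type*} [NonUnitalCStarAlgebra B] [NonUnitalCStarAlgebra C]
    (ν : CStarNorm (B ⊗[ℂ] C)) : Type _ :=
  CStarCompletion (WithCStarNorm ν)

/-- A C⋆-algebra `A` is essentially non-factorizable if it is not ⋆-isomorphic to `B ⊗_ν C` for any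
two infinite-dimensional C⋆-algebras `B`, `C` (unital or not) and any C⋆-norm `ν` on `B ⊙ C`. -/
def EssentiallyNonFactorizable (A : Type u) [NonUnitalCStarAlgebra A] : Prop :=
  ∀ (B : Type v) (C : Type w) [NonUnitalCStarAlgebra B] [NonUnitalCStarAlgebra C],
    ¬ FiniteDimensional ℂ B → ¬ FiniteDimensional ℂ C →
      ∀ ν : CStarNorm (B ⊗[ℂ] C), IsEmpty (A ≃⋆ₐ[ℂ] CStarTensorProduct ν)

/-! ### The Calkin algebra -/

section Calkin

variable (H : Type*) [NormedAddCommGroup H] [InnerProductSpace ℂ H]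

/-- The ideal `K(H)` of compact operators in `B(H)`. -/
def compactIdeal : Ideal (H →L[ℂ] H) where
  carrier := {T | IsCompactOperator T}
  add_mem' hS hT := hS.add hT
  zero_mem' := isCompactOperator_zero
  smul_mem' S _ hT := hT.clm_comp S

variable {H}

theorem mem_compactIdeal {T : H →L[ℂ] H} : T ∈ compactIdeal H ↔ IsCompactOperator T := Iff.rfl

instance : (compactIdeal H).IsTwoSided := ⟨fun {_} S hT => IsCompactOperator.comp_clm hT S⟩

variable (H) in
/-- The Calkin algebra `B(H) / K(H)`. -/
def CalkinAlgebra : Type _ := (H →L[ℂ] H) ⧸ compactIdeal H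

namespace CalkinAlgebra

instance : Ring (CalkinAlgebra H) := inferInstanceAs (Ring ((H →L[ℂ] H) ⧸ compactIdeal H))

instance : Algebra ℂ (CalkinAlgebra H) :=
  inferInstanceAs (Algebra ℂ ((H →L[ℂ] H) ⧸ compactIdeal H))

/-- The quotient map of `B(H)` onto the Calkin algebra. -/
def mk : (H →L[ℂ] H) →ₐ[ℂ] CalkinAlgebra H := Ideal.Quotient.mkₐ ℂ (compactIdeal H)

theorem mk_surjective : Function.Surjective (mk : (H →L[ℂ] H) → CalkinAlgebra H) :=
  Ideal.Quotient.mkₐ_surjective ℂ _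

theorem mk_eq_mk {S T : H →L[ℂ] H} : mk S = mk T ↔ S - T ∈ compactIdeal H :=
  Ideal.Quotient.eq

end CalkinAlgebra

variable [CompleteSpace H]

instance : IsClosed (compactIdeal H : Set (H →L[ℂ] H)) := isClosed_setOfPred_isCompactOperator

/-- A compact operator is approximated in norm, on the left, by finite-rank projections. -/
theorem exists_projection_of_isCompactOperator {T : H →L[ℂ] H} (hT : IsCompactOperator T)
    {ε : ℝ} (hε : 0 < ε) :
    ∃ P : H →L[ℂ] H, IsCompactOperator P ∧ star (1 - P) = 1 - P ∧ ‖1 - P‖ ≤ 1 ∧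
      ‖(1 - P) * T‖ ≤ ε := by
  obtain ⟨t, ht, hcov⟩ := Metric.totallyBounded_iff.1
    ((hT.isCompact_closure_image_closedBall (f := (T : H →ₗ[ℂ] H)) 1).totallyBounded) ε hε
  let U : Submodule ℂ H := Submodule.span ℂ t
  have : FiniteDimensional ℂ U := FiniteDimensional.span_of_finite ℂ ht
  have hP : (1 : H →L[ℂ] H) - U.starProjection = Uᗮ.starProjection := by
    rw [Submodule.starProjection_orthogonal']
  refine ⟨U.starProjection, ?_, ?_, ?_, ?_⟩
  · exact IsCompactOperator.clm_comp (f := U.orthogonalProjectionOnto)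
      (isCompactOperator_of_locallyCompactSpace_dom U.orthogonalProjectionOnto) U.subtypeL
  · rw [hP]
    exact (isSelfAdjoint_starProjection Uᗮ)
  · rw [hP]
    exact Submodule.starProjection_norm_le _
  · refine ContinuousLinearMap.opNorm_le_of_unit_norm hε.le fun x hx => ?_
    have hmem : T x ∈ closure ((T : H →ₗ[ℂ] H) '' Metric.closedBall 0 1) :=
      subset_closure ⟨x, by simp [hx], rfl⟩
    obtain ⟨y, hy, hxy⟩ := Set.mem_iUnion₂.1 (hcov hmem)
    have hyU : y ∈ U := Submodule.subset_span hy
    have h1 : (1 - U.starProjection) y = 0 := by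
      simp [Submodule.starProjection_eq_self_iff.2 hyU]
    calc ‖((1 - U.starProjection) * T) x‖ = ‖(1 - U.starProjection) (T x - y)‖ := by
          rw [map_sub, h1, sub_zero]; rfl
      _ ≤ ‖(1 : H →L[ℂ] H) - U.starProjection‖ * ‖T x - y‖ :=
          ContinuousLinearMap.le_opNorm _ _
      _ ≤ 1 * ‖T x - y‖ := by
          gcongr
          rw [hP]
          exact Submodule.starProjection_norm_le _
      _ ≤ ε := by
          rw [one_mul, ← dist_eq_norm]
          exact (Metric.mem_ball.1 hxy).le

theorem star_mem_compactIdeal {T : H →L[ℂ] H} (hT : T ∈ compactIdeal H) :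
    star T ∈ compactIdeal H := by
  have hcl : IsClosed (compactIdeal H : Set (H →L[ℂ] H)) := inferInstance
  change star T ∈ (compactIdeal H : Set (H →L[ℂ] H))
  rw [← hcl.closure_eq]
  refine Metric.mem_closure_iff.2 fun ε hε => ?_
  obtain ⟨P, hP, hs, -, hn⟩ := exists_projection_of_isCompactOperator hT (half_pos hε)
  refine ⟨star T * P, (compactIdeal H).mul_mem_left _ hP, ?_⟩
  have : star T - star T * P = star ((1 - P) * T) := by
    rw [star_mul, hs, mul_sub, mul_one]
  rw [dist_eq_norm, this, norm_star]
  linarith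

namespace CalkinAlgebra

/-- The quotient norm. -/
instance : NormedAddCommGroup (CalkinAlgebra H) :=
  inferInstanceAs (NormedAddCommGroup ((H →L[ℂ] H) ⧸ compactIdeal H))

instance : CompleteSpace (CalkinAlgebra H) :=
  inferInstanceAs (CompleteSpace ((H →L[ℂ] H) ⧸ compactIdeal H))

theorem norm_mk_le (T : H →L[ℂ] H) : ‖mk T‖ ≤ ‖T‖ :=
  Submodule.Quotient.norm_mk_le (compactIdeal H) T

theorem exists_norm_lt (x : CalkinAlgebra H) {ε : ℝ} (hε : 0 < ε) :
    ∃ T : H →L[ℂ] H, mk T = x ∧ ‖T‖ < ‖x‖ + ε :=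
  Submodule.Quotient.norm_mk_lt (S := compactIdeal H) x hε

instance : NormedRing (CalkinAlgebra H) where
  dist_eq := NormedAddCommGroup.dist_eq
  norm_mul_le x y := by
    refine le_of_forall_gt_imp_ge_of_dense fun c hc => ?_
    have hlim : Filter.Tendsto (fun ε : ℝ => (‖x‖ + ε) * (‖y‖ + ε)) (nhdsWithin 0 (Set.Ioi 0))
        (nhds (‖x‖ * ‖y‖)) := by
      have : Continuous fun ε : ℝ => (‖x‖ + ε) * (‖y‖ + ε) := by fun_prop
      simpa using (this.tendsto 0).mono_left nhdsWithin_le_nhds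
    obtain ⟨ε, hεc, hε⟩ :=
      ((hlim.eventually (gt_mem_nhds hc)).and self_mem_nhdsWithin).exists
    obtain ⟨S, rfl, hS⟩ := exists_norm_lt x hε
    obtain ⟨T, rfl, hT⟩ := exists_norm_lt y hε
    rw [← map_mul]
    calc ‖mk (S * T)‖ ≤ ‖S * T‖ := norm_mk_le _
      _ ≤ ‖S‖ * ‖T‖ := norm_mul_le _ _
      _ ≤ (‖mk S‖ + ε) * (‖mk T‖ + ε) := by gcongr
      _ ≤ c := hεc.le

instance : NormedAlgebra ℂ (CalkinAlgebra H) where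
  norm_smul_le c x :=
    norm_smul_le (α := ℂ) (β := (H →L[ℂ] H) ⧸ compactIdeal H) c x

/-- The involution induced by the adjoint. -/
instance : Star (CalkinAlgebra H) where
  star := Quotient.map' star fun S T h => by
    rw [Submodule.quotientRel_def] at h ⊢
    rw [← star_sub]
    exact star_mem_compactIdeal h

theorem mk_star (T : H →L[ℂ] H) : mk (star T) = star (mk T) := rfl

instance : StarRing (CalkinAlgebra H) where
  star_involutive x := by
    obtain ⟨T, rfl⟩ := mk_surjective x
    simp only [← mk_star, star_star]
  star_mul x y := by
    obtain ⟨S, rfl⟩ := mk_surjective x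
    obtain ⟨T, rfl⟩ := mk_surjective y
    simp only [← mk_star, ← map_mul, star_mul]
  star_add x y := by
    obtain ⟨S, rfl⟩ := mk_surjective x
    obtain ⟨T, rfl⟩ := mk_surjective y
    simp only [← mk_star, ← map_add, star_add]

instance : CStarRing (CalkinAlgebra H) where
  norm_mul_self_le x := by
    obtain ⟨T, rfl⟩ := mk_surjective x
    refine le_of_forall_pos_le_add fun ε hε => ?_
    obtain ⟨S, hS, hSn⟩ := exists_norm_lt (star (mk T) * mk T) (half_pos hε)
    rw [← mk_star, ← map_mul] at hS hSn ⊢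
    obtain ⟨P, hP, hs, hn, hK⟩ :=
      exists_projection_of_isCompactOperator (mk_eq_mk.1 hS.symm) (half_pos hε)
    have hT : mk T = mk (T * (1 - P)) := by
      rw [mk_eq_mk, mul_sub, mul_one, sub_sub_cancel]
      exact (compactIdeal H).mul_mem_left _ hP
    have hTP : star (T * (1 - P)) * (T * (1 - P)) =
        (1 - P) * S * (1 - P) + (1 - P) * (star T * T - S) * (1 - P) := by
      rw [star_mul, hs]
      noncomm_ring
    have h1 : ‖(1 - P) * S * (1 - P)‖ ≤ ‖S‖ := by
      calc ‖(1 - P) * S * (1 - P)‖ ≤ ‖1 - P‖ * ‖S‖ * ‖1 - P‖ :=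
            (norm_mul_le _ _).trans (by gcongr; exact norm_mul_le _ _)
        _ ≤ 1 * ‖S‖ * 1 := by gcongr
        _ = ‖S‖ := by ring
    have h2 : ‖(1 - P) * (star T * T - S) * (1 - P)‖ ≤ ε / 2 := by
      calc ‖(1 - P) * (star T * T - S) * (1 - P)‖
          ≤ ‖(1 - P) * (star T * T - S)‖ * ‖1 - P‖ := norm_mul_le _ _
        _ ≤ ε / 2 * 1 := by gcongr
        _ = ε / 2 := mul_one _
    calc ‖mk T‖ * ‖mk T‖ ≤ ‖T * (1 - P)‖ * ‖T * (1 - P)‖ := by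
          rw [hT]
          gcongr <;> exact norm_mk_le _
      _ = ‖star (T * (1 - P)) * (T * (1 - P))‖ := CStarRing.norm_star_mul_self.symm
      _ ≤ ‖S‖ + ε / 2 := by
          rw [hTP]
          exact (norm_add_le _ _).trans (add_le_add h1 h2)
      _ ≤ ‖mk (star T * T)‖ + ε := by linarith

/-- The Calkin algebra is a C⋆-algebra. -/
instance : CStarAlgebra (CalkinAlgebra H) where
  star_smul c x := by
    obtain ⟨T, rfl⟩ := mk_surjective x
    simp only [← mk_star, ← map_smul, star_smul]

end CalkinAlgebra

end Calkin

end

/-! ### C⋆-norms on a tensor product are cross norms -/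

section CrossNorm

variable {B : Type v} [NonUnitalCStarAlgebra B]

/-! The obstruction is a separation property. In the Calkin algebra two orthogonal positive elements
lift to orthogonal positive operators, and a range projection in `B(H)` then gives an `e` that is a
left unit on one and kills the other (`separatesOrthogonal_calkinAlgebra`). By weighted sums, this
separates any two complementary classes of a countable orthogonal family.

A completed tensor product of infinite-dimensional factors cannot do this. Each factor contains an
infinite orthogonal sequence (`hasOrthogonalSequence_of_not_finiteDimensional`), giving an
orthogonal grid `q n ⊗ s m`. Let `e` separate the diagonal from the rest, and approximate it by a
finite sum `z` of simple tensors. Compressing the second legs of `z` to a small right ideal of `C`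
makes them nearly scalar (`isExcised`), so near column `m` the tensor `z` looks like a single `k m`
in `B`, and all the `k m` lie in one compact set. But `k m` must act nearly as a unit at `q m` and
nearly as zero at every other `q n`, so distinct `k m` stay uniformly apart, which contradicts
compactness.

Norm estimates in the completion become estimates in the factors because every C⋆-norm is a cross
norm (`norm_map_tmul`). -/

theorem tmul_ne_zero_of_ne_zero {V W : Type*} [AddCommGroup V] [Module ℂ V] [AddCommGroup W]
    [Module ℂ W] {x : V} {y : W} (hx : x ≠ 0) (hy : y ≠ 0) : x ⊗ₜ[ℂ] y ≠ 0 := by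
  rw [Ne, ← Module.forall_dual_apply_eq_zero_iff ℂ, not_forall] at hx hy
  obtain ⟨f, hf⟩ := hx
  obtain ⟨g, hg⟩ := hy
  intro h
  refine mul_ne_zero hf hg ?_
  rw [← TensorProduct.dualDistrib_apply, h, map_zero]

theorem mul_self_le_norm_smul_of_nonneg [PartialOrder B] [StarOrderedRing B] {b : B} (hb : 0 ≤ b) :
    b * b ≤ ‖b‖ • b := by
  have h := CStarAlgebra.star_left_conjugate_le_norm_smul (a := CFC.sqrt b) (b := b)
  have h1 : star (CFC.sqrt b) = CFC.sqrt b := (IsSelfAdjoint.of_nonneg (CFC.sqrt_nonneg b)).star_eq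
  have h2 : CFC.sqrt b * CFC.sqrt b = b := CFC.sqrt_mul_sqrt_self b
  rw [h1, h2] at h
  have : CFC.sqrt b * b * CFC.sqrt b = b * b := by
    nth_rw 2 [← h2]
    rw [← mul_assoc, h2, mul_assoc, h2]
  rwa [this] at h

/-- Take `f = (b - r)₊`. It is nonzero because the spectrum of `b` reaches beyond `r`, and `t ≥ r`
wherever `(t - r)₊` does not vanish. -/
theorem exists_nonneg_smul_le_mul [PartialOrder B] [StarOrderedRing B] {b : B} (hb : 0 ≤ b)
    {r : ℝ} (hr : 0 ≤ r) (hrb : r < ‖b‖) : ∃ f : B, 0 ≤ f ∧ f ≠ 0 ∧ r • f ≤ b * f := by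
  have hsa : IsSelfAdjoint b := .of_nonneg hb
  let φ : ℝ → ℝ := fun t => max (t - r) 0
  have hφ : Continuous φ := by fun_prop
  have hφ0 : φ 0 = 0 := by simp [φ, hr]
  refine ⟨cfcₙ φ b, cfcₙ_nonneg fun t _ => le_max_right _ _, fun h => ?_, ?_⟩
  · have h' : cfcₙ φ b = cfcₙ (0 : ℝ → ℝ) b := by rw [h]; exact (cfcₙ_zero ℝ b).symm
    have heq := (cfcₙ_eq_cfcₙ_iff_eqOn hsa (by fun_prop) hφ0).1 h'
    have : ‖cfcₙ (id : ℝ → ℝ) b‖ ≤ r := by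
      refine norm_cfcₙ_le fun t ht => ?_
      have h1 : max (t - r) 0 = 0 := heq ht
      have h2 : 0 ≤ t := quasispectrum_nonneg_of_nonneg b hb t ht
      rw [id, Real.norm_of_nonneg h2]
      linarith [max_eq_right_iff.1 h1]
    rw [cfcₙ_id ℝ b] at this
    linarith
  · have h1 : r • cfcₙ φ b = cfcₙ (fun t => r • φ t) b := (cfcₙ_smul r φ b).symm
    have h2 : b * cfcₙ φ b = cfcₙ (fun t => t * φ t) b := by
      conv_lhs => rw [← cfcₙ_id ℝ b]
      rw [cfcₙ_id ℝ b, cfcₙ_mul (fun t => t) φ b, cfcₙ_id' ℝ b]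
    rw [h1, h2]
    refine cfcₙ_mono fun t _ => ?_
    simp only [φ, smul_eq_mul]
    rcases le_total (t - r) 0 with h | h
    · simp [h]
    · rw [max_eq_left h]
      nlinarith

variable {C : Type w} [NonUnitalCStarAlgebra C] {A : Type*} [NonUnitalCStarAlgebra A]
  (j : B ⊗[ℂ] C →⋆ₙₐ[ℂ] A)

theorem map_tmul_mul_tmul (b b' : B) (c c' : C) :
    j (b ⊗ₜ c) * j (b' ⊗ₜ c') = j ((b * b') ⊗ₜ (c * c')) := by
  rw [← map_mul, Algebra.TensorProduct.tmul_mul_tmul]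

theorem map_tmul_star (b : B) (c : C) : star (j (b ⊗ₜ c)) = j (star b ⊗ₜ star c) := by
  rw [← map_star, TensorProduct.star_tmul]

theorem map_real_smul_tmul (r : ℝ) (b : B) (c : C) : j ((r • b) ⊗ₜ c) = r • j (b ⊗ₜ c) := by
  rw [← Complex.coe_smul, ← Complex.coe_smul, ← TensorProduct.smul_tmul', map_smul]

theorem map_tmul_real_smul (r : ℝ) (b : B) (c : C) : j (b ⊗ₜ (r • c)) = r • j (b ⊗ₜ c) := by
  rw [← Complex.coe_smul, ← Complex.coe_smul, TensorProduct.tmul_smul, map_smul]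

section Order

variable [PartialOrder B] [StarOrderedRing B] [PartialOrder C] [StarOrderedRing C]
  [PartialOrder A] [StarOrderedRing A]

theorem map_tmul_nonneg {b : B} {c : C} (hb : 0 ≤ b) (hc : 0 ≤ c) : 0 ≤ j (b ⊗ₜ c) := by
  obtain ⟨x, rfl⟩ := CStarAlgebra.nonneg_iff_eq_star_mul_self.1 hb
  obtain ⟨y, rfl⟩ := CStarAlgebra.nonneg_iff_eq_star_mul_self.1 hc
  rw [← map_tmul_mul_tmul, ← map_tmul_star]
  exact star_mul_self_nonneg _

theorem map_tmul_mono {b b' : B} {c c' : C} (hb : 0 ≤ b) (hc' : 0 ≤ c') (hbb : b ≤ b')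
    (hcc : c ≤ c') : j (b ⊗ₜ c) ≤ j (b' ⊗ₜ c') := by
  have h1 := map_tmul_nonneg j hb (sub_nonneg.2 hcc)
  have h2 := map_tmul_nonneg j (sub_nonneg.2 hbb) hc'
  rw [TensorProduct.tmul_sub, map_sub, sub_nonneg] at h1
  rw [TensorProduct.sub_tmul, map_sub, sub_nonneg] at h2
  exact h1.trans h2

/-- With `a = j (b ⊗ c)`, the inequalities `b² ≤ ‖b‖ b` and `c² ≤ ‖c‖ c` give `a² ≤ ‖b‖ ‖c‖ a`;
taking norms bounds `‖a‖`. No continuity of `j` is needed. -/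
theorem norm_map_tmul_le_of_nonneg {b : B} {c : C} (hb : 0 ≤ b) (hc : 0 ≤ c) :
    ‖j (b ⊗ₜ c)‖ ≤ ‖b‖ * ‖c‖ := by
  have h0 := map_tmul_nonneg j hb hc
  have hbb : 0 ≤ b * b := by
    simpa [(IsSelfAdjoint.of_nonneg hb).star_eq] using star_mul_self_nonneg b
  have h1 : j (b ⊗ₜ c) * j (b ⊗ₜ c) ≤ (‖b‖ * ‖c‖) • j (b ⊗ₜ c) := by
    rw [map_tmul_mul_tmul, mul_smul, ← map_tmul_real_smul, ← map_real_smul_tmul]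
    exact map_tmul_mono j hbb (smul_nonneg (norm_nonneg _) hc)
      (mul_self_le_norm_smul_of_nonneg hb) (mul_self_le_norm_smul_of_nonneg hc)
  have hsa := (IsSelfAdjoint.of_nonneg h0).star_eq
  have h2 : ‖j (b ⊗ₜ c)‖ * ‖j (b ⊗ₜ c)‖ ≤ (‖b‖ * ‖c‖) * ‖j (b ⊗ₜ c)‖ := by
    rw [← CStarRing.norm_star_mul_self, hsa]
    refine (CStarAlgebra.norm_le_norm_of_nonneg_of_le ?_ h1).trans ?_
    · simpa [hsa] using star_mul_self_nonneg (j (b ⊗ₜ c))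
    · rw [norm_smul, Real.norm_of_nonneg (by positivity)]
  rcases (norm_nonneg (j (b ⊗ₜ c))).eq_or_lt with h | h
  · rw [← h]; positivity
  · exact le_of_mul_le_mul_right h2 h

/-- For the lower bound, `f` and `g` nearly attain the norms of `b` and `c`, and `j (f ⊗ g)` is
nonzero by injectivity, so its norm cancels from `r s ‖j (f ⊗ g)‖ ≤ ‖j (b ⊗ c)‖ ‖j (f ⊗ g)‖`. -/
theorem norm_map_tmul_of_nonneg (hj : Function.Injective j) {b : B} {c : C} (hb : 0 ≤ b)
    (hc : 0 ≤ c) : ‖j (b ⊗ₜ c)‖ = ‖b‖ * ‖c‖ := by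
  refine (norm_map_tmul_le_of_nonneg j hb hc).antisymm ?_
  have key : ∀ r s : ℝ, 0 ≤ r → r < ‖b‖ → 0 ≤ s → s < ‖c‖ → r * s ≤ ‖j (b ⊗ₜ c)‖ := by
    intro r s hr hrb hs hsc
    obtain ⟨f, hf0, hf, hfb⟩ := exists_nonneg_smul_le_mul hb hr hrb
    obtain ⟨g, hg0, hg, hgc⟩ := exists_nonneg_smul_le_mul hc hs hsc
    have hpos : 0 < ‖j (f ⊗ₜ g)‖ :=
      norm_pos_iff.2 ((map_ne_zero_iff j hj).2 (tmul_ne_zero_of_ne_zero hf hg))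
    have hle : (r * s) • j (f ⊗ₜ g) ≤ j (b ⊗ₜ c) * j (f ⊗ₜ g) := by
      rw [map_tmul_mul_tmul, mul_smul, ← map_tmul_real_smul, ← map_real_smul_tmul]
      exact map_tmul_mono j (smul_nonneg hr hf0) ((smul_nonneg hs hg0).trans hgc) hfb hgc
    have h := CStarAlgebra.norm_le_norm_of_nonneg_of_le
      (smul_nonneg (mul_nonneg hr hs) (map_tmul_nonneg j hf0 hg0)) hle
    rw [norm_smul, Real.norm_of_nonneg (by positivity)] at h
    exact le_of_mul_le_mul_right (h.trans (norm_mul_le _ _)) hpos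
  rcases (norm_nonneg b).eq_or_lt with h | hb0
  · rw [← h, zero_mul]; positivity
  rcases (norm_nonneg c).eq_or_lt with h | hc0
  · rw [← h, mul_zero]; positivity
  set P := ‖b‖ * ‖c‖
  set N := ‖j (b ⊗ₜ c)‖
  have hP : 0 < P := mul_pos hb0 hc0
  by_contra! hNP
  have h0 : 0 ≤ N / P := by positivity
  have h1 : N / P < 1 := (div_lt_one hP).2 hNP
  have h2 : N / P * P = N := div_mul_cancel₀ _ hP.ne'
  -- The midpoint `t` of `N / P` and `1` satisfies `t < 1` and, by the strict AM-GM inequality, `t²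
  -- > N / P`.
  set t := (1 + N / P) / 2 with ht
  have h3 := key (t * ‖b‖) (t * ‖c‖) (by positivity) (by nlinarith) (by positivity) (by nlinarith)
  have h4 : t * ‖b‖ * (t * ‖c‖) = t ^ 2 * P := by ring
  have h5 : N / P < t ^ 2 := by nlinarith
  nlinarith

end Order

theorem norm_map_tmul (hj : Function.Injective j) (b : B) (c : C) :
    ‖j (b ⊗ₜ c)‖ = ‖b‖ * ‖c‖ := by
  let _ := CStarAlgebra.spectralOrder A
  let _ := CStarAlgebra.spectralOrder B
  let _ := CStarAlgebra.spectralOrder C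
  have := CStarAlgebra.spectralOrderedRing A
  have := CStarAlgebra.spectralOrderedRing B
  have := CStarAlgebra.spectralOrderedRing C
  have h := norm_map_tmul_of_nonneg j hj (star_mul_self_nonneg b) (star_mul_self_nonneg c)
  rw [← map_tmul_mul_tmul, ← map_tmul_star, CStarRing.norm_star_mul_self,
    CStarRing.norm_star_mul_self, CStarRing.norm_star_mul_self] at h
  have : ‖j (b ⊗ₜ c)‖ ^ 2 = (‖b‖ * ‖c‖) ^ 2 := by rw [sq, h]; ring
  exact (pow_left_inj₀ (norm_nonneg _) (by positivity) two_ne_zero).1 this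

end CrossNorm

/-! ### Excision: compressions to small right ideals -/

section Excision

/-- Take for `μ` the infimum of the `r` with `y ≤ r` as a form on the right ideal `h C`. The upper
bound by `μ + δ` then holds on all of `h C`. The bound `μ - δ` fails at some `x` in `h C`, and
cutting down by the positive part of the defect gives a smaller ideal on which the lower bound
holds. -/
theorem exists_sub_smul_le {C : Type*} [NonUnitalCStarAlgebra C] [PartialOrder C]
    [StarOrderedRing C] {y h : C} (hy : IsSelfAdjoint y) (hh : h ≠ 0) {δ : ℝ} (hδ : 0 < δ) :
    ∃ μ : ℝ, |μ| ≤ ‖y‖ ∧ ∃ u : C, h * u ≠ 0 ∧ ∀ w : C,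
      (μ - δ) • (star (h * u * w) * (h * u * w)) ≤ star (h * u * w) * y * (h * u * w) ∧
      star (h * u * w) * y * (h * u * w) ≤ (μ + δ) • (star (h * u * w) * (h * u * w)) := by
  let S : Set ℝ := {r | ∀ u : C, star (h * u) * y * (h * u) ≤ r • (star (h * u) * (h * u))}
  have hlow : ∀ x : C, (-‖y‖) • (star x * x) ≤ star x * y * x := fun x => by
    have := CStarAlgebra.star_left_conjugate_le_norm_smul (a := x) (b := -y) hy.neg
    rw [norm_neg, mul_neg, neg_mul] at this
    rw [neg_smul]
    exact neg_le.1 this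
  have hmem : ‖y‖ ∈ S := fun u => CStarAlgebra.star_left_conjugate_le_norm_smul hy
  have hpos : h * star h ≠ 0 := by
    simpa using hh
  have hbdd : ∀ r ∈ S, -‖y‖ ≤ r := by
    intro r hr
    by_contra! hlt
    -- Without a unit, `h * star h` serves as a nonzero element of the ideal to test `r` on.
    have h1 := (hlow (h * star h)).trans (hr (star h))
    rw [← sub_nonneg, ← sub_smul] at h1
    have h2 : (r - -‖y‖) • (star (h * star h) * (h * star h)) ≤ 0 :=
      smul_nonpos_of_nonpos_of_nonneg (by linarith) (star_mul_self_nonneg _)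
    have h3 := smul_eq_zero.1 (h2.antisymm h1)
    rcases h3 with h3 | h3
    · linarith
    · exact hpos (CStarRing.star_mul_self_eq_zero_iff _ |>.1 h3)
  have hB : BddBelow S := ⟨-‖y‖, hbdd⟩
  set μ := sInf S with hμ
  have hμ1 : -‖y‖ ≤ μ := le_csInf ⟨_, hmem⟩ hbdd
  have hμ2 : μ ≤ ‖y‖ := csInf_le hB hmem
  obtain ⟨r, hrS, hr⟩ := exists_lt_of_csInf_lt ⟨_, hmem⟩ (show sInf S < μ + δ by linarith)
  have hnot : μ - δ ∉ S := fun hin => by linarith [csInf_le hB hin]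
  simp only [S, Set.mem_ofPred_eq, not_forall] at hnot
  obtain ⟨u, hu⟩ := hnot
  set x := h * u with hx
  set k := star x * y * x - (μ - δ) • (star x * x) with hk
  have hksa : IsSelfAdjoint k := by
    refine IsSelfAdjoint.sub ?_ (IsSelfAdjoint.smul (IsSelfAdjoint.all _) (.star_mul_self x))
    exact hy.conjugate' x
  have hkp : k⁺ ≠ 0 := fun h0 => by
    rw [CFC.posPart_eq_zero_iff k hksa, sub_nonpos] at h0
    exact hu h0
  have hkp_sa : star k⁺ = k⁺ := (IsSelfAdjoint.of_nonneg (CFC.posPart_nonneg k)).star_eq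
  have hcube : k⁺ * k * k⁺ = k⁺ * k⁺ * k⁺ := by
    nth_rw 2 [← CFC.posPart_sub_negPart k]
    rw [mul_sub, CFC.posPart_mul_negPart, sub_zero]
  have hcube_nonneg : 0 ≤ k⁺ * k⁺ * k⁺ := by
    simpa [hkp_sa] using star_left_conjugate_nonneg (CFC.posPart_nonneg k) k⁺
  have hcube_ne : k⁺ * k⁺ * k⁺ ≠ 0 := fun h0 => by
    have h1 : (k⁺ * k⁺) * (k⁺ * k⁺) = 0 := by rw [← mul_assoc, h0, zero_mul]
    have h2 : star (k⁺ * k⁺) * (k⁺ * k⁺) = 0 := by rw [star_mul, hkp_sa, h1]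
    have h3 : star k⁺ * k⁺ = 0 := by
      rw [hkp_sa]; exact (CStarRing.star_mul_self_eq_zero_iff _).1 h2
    exact hkp ((CStarRing.star_mul_self_eq_zero_iff _).1 h3)
  have hconj : ∀ v : C, star (x * v) * y * (x * v) - (μ - δ) • (star (x * v) * (x * v)) =
      star v * k * v := fun v => by
    rw [hk, mul_sub, sub_mul, star_mul, mul_smul_comm, smul_mul_assoc]
    simp only [mul_assoc]
  -- On `x k⁺ C` the defect becomes a conjugate of `k⁺ k k⁺ = (k⁺)³ ≥ 0`; the same cube being
  -- nonzero shows that `x k⁺ ≠ 0`.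
  refine ⟨μ, abs_le.2 ⟨hμ1, hμ2⟩, u * k⁺, fun h0 => ?_, fun w => ⟨?_, ?_⟩⟩
  · have hx0 : x * k⁺ = 0 := by rw [hx, mul_assoc, h0]
    have := hconj k⁺
    rw [hx0, hkp_sa, hcube, star_zero, zero_mul, zero_mul, smul_zero, sub_zero] at this
    exact hcube_ne this.symm
  · rw [← sub_nonneg]
    have h1 : h * (u * k⁺) * w = x * (k⁺ * w) := by simp only [hx, mul_assoc]
    rw [h1, hconj, star_mul, hkp_sa]
    have h2 : star w * k⁺ * k * (k⁺ * w) = star w * (k⁺ * k * k⁺) * w := by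
      simp only [mul_assoc]
    rw [h2, hcube]
    exact star_left_conjugate_nonneg hcube_nonneg w
  · rw [mul_assoc h]
    exact (hrS _).trans (smul_le_smul_of_nonneg_right hr.le (star_mul_self_nonneg _))

/-- Compressing a self-adjoint element to a small right ideal makes it almost scalar. -/
theorem exists_norm_conjugate_sub_smul_le {C : Type*} [NonUnitalCStarAlgebra C] {y : C}
    (hy : IsSelfAdjoint y) {δ : ℝ} (hδ : 0 < δ) {h : C} (hh : h ≠ 0) :
    ∃ μ : ℝ, |μ| ≤ ‖y‖ ∧ ∃ u : C, h * u ≠ 0 ∧ ∀ w : C,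
      ‖star (h * u * w) * y * (h * u * w) - μ • (star (h * u * w) * (h * u * w))‖ ≤
        δ * ‖h * u * w‖ ^ 2 := by
  let _ := CStarAlgebra.spectralOrder C
  have := CStarAlgebra.spectralOrderedRing C
  -- Shifting by `δ / 3` makes the difference positive and at most `2δ / 3` times `x⋆ x`, so its
  -- norm is controlled; shifting back costs another `δ / 3`.
  obtain ⟨μ, hμ, u, hu, H⟩ := exists_sub_smul_le hy hh (δ := δ / 3) (by positivity)
  refine ⟨μ, hμ, u, hu, fun w => ?_⟩
  obtain ⟨h1, h2⟩ := H w
  set x := h * u * w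
  have h3 : 0 ≤ star x * y * x - (μ - δ / 3) • (star x * x) := sub_nonneg.2 h1
  have h4 : star x * y * x - (μ - δ / 3) • (star x * x) ≤ (2 * (δ / 3)) • (star x * x) := by
    rw [sub_le_iff_le_add, ← add_smul]
    convert h2 using 2
    ring
  have h5 := CStarAlgebra.norm_le_norm_of_nonneg_of_le h3 h4
  rw [norm_smul, Real.norm_of_nonneg (by positivity), CStarRing.norm_star_mul_self] at h5
  have h6 : star x * y * x - μ • (star x * x) =
      (star x * y * x - (μ - δ / 3) • (star x * x)) - (δ / 3) • (star x * x) := by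
    rw [sub_sub, ← add_smul]
    congr 2
    ring
  rw [h6]
  refine (norm_sub_le _ _).trans ?_
  rw [norm_smul, Real.norm_of_nonneg (by positivity : 0 ≤ δ / 3), CStarRing.norm_star_mul_self]
  linarith

variable {B : Type v} [NonUnitalCStarAlgebra B] {C : Type w} [NonUnitalCStarAlgebra C]
  {A : Type*} [NonUnitalCStarAlgebra A] (j : B ⊗[ℂ] C →⋆ₙₐ[ℂ] A)

/-- Compressions of `j z` by suitable simple tensors `p ⊗ x` are uniformly close to simple tensors
`p⋆ k p ⊗ x⋆ x`, with `k` in a compact subset of the first factor. -/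
def IsExcised (z : B ⊗[ℂ] C) : Prop :=
  ∀ ε > 0, ∃ K : Set B, IsCompact K ∧ ∀ h : C, h ≠ 0 → ∃ u : C, h * u ≠ 0 ∧ ∃ k ∈ K,
    ∀ (p : B) (w : C),
      ‖star (j (p ⊗ₜ (h * u * w))) * j z * j (p ⊗ₜ (h * u * w)) -
        j ((star p * k * p) ⊗ₜ (star (h * u * w) * (h * u * w)))‖ ≤
          ε * (‖p‖ ^ 2 * ‖h * u * w‖ ^ 2)

variable {j}

/-- Here `k = μ b` with `|μ| ≤ ‖y‖`, so a segment independent of `h` serves as the compact set. The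
error is the image of one simple tensor, whose norm the cross-norm identity computes. -/
theorem isExcised_tmul (hj : Function.Injective j) (b : B) {y : C} (hy : IsSelfAdjoint y) :
    IsExcised j (b ⊗ₜ y) := by
  intro ε hε
  refine ⟨(fun r : ℝ => r • b) '' Set.Icc (-‖y‖) ‖y‖, isCompact_Icc.image (by fun_prop),
    fun h hh => ?_⟩
  obtain ⟨μ, hμ, u, hu, H⟩ := exists_norm_conjugate_sub_smul_le hy (δ := ε / (‖b‖ + 1))
    (by positivity) hh
  refine ⟨u, hu, μ • b, ⟨μ, abs_le.1 hμ, rfl⟩, fun p w => ?_⟩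
  have := H w
  set x := h * u * w
  have heq : star (j (p ⊗ₜ x)) * j (b ⊗ₜ y) * j (p ⊗ₜ x) -
      j ((star p * (μ • b) * p) ⊗ₜ (star x * x)) =
      j ((star p * b * p) ⊗ₜ (star x * y * x - μ • (star x * x))) := by
    rw [map_tmul_star, map_tmul_mul_tmul, map_tmul_mul_tmul, TensorProduct.tmul_sub, map_sub,
      mul_smul_comm, smul_mul_assoc, map_real_smul_tmul, map_tmul_real_smul]
  rw [heq, norm_map_tmul j hj]
  have h1 : ‖star p * b * p‖ ≤ ‖b‖ * ‖p‖ ^ 2 := by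
    calc ‖star p * b * p‖ ≤ ‖star p‖ * ‖b‖ * ‖p‖ :=
          (norm_mul_le _ _).trans (by gcongr; exact norm_mul_le _ _)
      _ = ‖b‖ * ‖p‖ ^ 2 := by rw [norm_star]; ring
  calc ‖star p * b * p‖ * ‖star x * y * x - μ • (star x * x)‖
      ≤ (‖b‖ * ‖p‖ ^ 2) * (ε / (‖b‖ + 1) * ‖x‖ ^ 2) := by gcongr
    _ = (‖b‖ / (‖b‖ + 1)) * (ε * (‖p‖ ^ 2 * ‖x‖ ^ 2)) := by ring
    _ ≤ 1 * (ε * (‖p‖ ^ 2 * ‖x‖ ^ 2)) := by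
        gcongr
        exact (div_le_one (by positivity)).2 (by linarith)
    _ = _ := one_mul _

open scoped Pointwise in
-- Since the estimate holds for all `w`, it survives shrinking the right ideal: the second tensor is
-- excised inside the ideal found for the first.
theorem IsExcised.add {z₁ z₂ : B ⊗[ℂ] C} (H₁ : IsExcised j z₁) (H₂ : IsExcised j z₂) :
    IsExcised j (z₁ + z₂) := by
  intro ε hε
  obtain ⟨K₁, hK₁, H₁⟩ := H₁ (ε / 2) (by positivity)
  obtain ⟨K₂, hK₂, H₂⟩ := H₂ (ε / 2) (by positivity)
  refine ⟨K₁ + K₂, hK₁.add hK₂, fun h hh => ?_⟩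
  obtain ⟨u, hu, k₁, hk₁, H₁⟩ := H₁ h hh
  obtain ⟨u', hu', k₂, hk₂, H₂⟩ := H₂ (h * u) hu
  refine ⟨u * u', by rwa [← mul_assoc], k₁ + k₂, Set.add_mem_add hk₁ hk₂, fun p w => ?_⟩
  have h₁ := H₁ p (u' * w)
  have h₂ := H₂ p w
  have e : h * u * (u' * w) = h * (u * u') * w := by simp only [mul_assoc]
  have e' : h * u * u' * w = h * (u * u') * w := by simp only [mul_assoc]
  rw [e] at h₁
  rw [e'] at h₂
  set x := h * (u * u') * w
  have heq : star (j (p ⊗ₜ x)) * j (z₁ + z₂) * j (p ⊗ₜ x) -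
      j ((star p * (k₁ + k₂) * p) ⊗ₜ (star x * x)) =
      (star (j (p ⊗ₜ x)) * j z₁ * j (p ⊗ₜ x) - j ((star p * k₁ * p) ⊗ₜ (star x * x))) +
      (star (j (p ⊗ₜ x)) * j z₂ * j (p ⊗ₜ x) - j ((star p * k₂ * p) ⊗ₜ (star x * x))) := by
    rw [map_add, mul_add, add_mul, mul_add, add_mul, TensorProduct.add_tmul, map_add]
    abel
  rw [heq]
  exact (norm_add_le _ _).trans (by linarith)

theorem isExcised (hj : Function.Injective j) (z : B ⊗[ℂ] C) : IsExcised j z := by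
  induction z with
  | zero => simpa using isExcised_tmul hj (0 : B) (.zero C)
  | add z₁ z₂ h₁ h₂ => exact h₁.add h₂
  | tmul b y =>
    -- Excision needs a self-adjoint second leg; the factor `i` moves to the first leg, where
    -- nothing is required.
    have : b ⊗ₜ[ℂ] y = b ⊗ₜ (realPart y : C) + (Complex.I • b) ⊗ₜ (imaginaryPart y : C) := by
      rw [TensorProduct.smul_tmul, ← TensorProduct.tmul_add, realPart_add_I_smul_imaginaryPart]
    rw [this]
    exact (isExcised_tmul hj _ (realPart y).2).add (isExcised_tmul hj _ (imaginaryPart y).2)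

end Excision

/-! ### Orthogonal sequences in infinite-dimensional C⋆-algebras -/

section OrthogonalSequence

variable {B : Type*} [NonUnitalCStarAlgebra B]

variable (B) in
/-- `B` contains infinitely many pairwise orthogonal nonzero self-adjoint elements. -/
def HasOrthogonalSequence : Prop :=
  ∃ b : ℕ → B, (∀ n, IsSelfAdjoint (b n)) ∧ (∀ n, b n ≠ 0) ∧ Pairwise fun m n => b m * b n = 0

/-- An infinite Hausdorff space has infinitely many disjoint nonempty open sets; tent functions
supported in them are orthogonal, and so are their values at `a`. -/
theorem hasOrthogonalSequence_of_infinite_quasispectrum {a : B} (ha : IsSelfAdjoint a)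
    (hinf : (quasispectrum ℝ a).Infinite) : HasOrthogonalSequence B := by
  let X : Set ℝ := quasispectrum ℝ a \ {0}
  have : Infinite X := (hinf.sdiff (Set.finite_singleton (0 : ℝ))).to_subtype
  obtain ⟨U, hUinf, hUo, hU⟩ := exists_seq_infinite_isOpen_pairwise_disjoint X
  choose x hx using fun n => (hUinf n).nonempty
  have hball : ∀ n, ∃ ε > 0, Metric.ball (x n) ε ⊆ U n := fun n =>
    Metric.isOpen_iff.1 (hUo n) (x n) (hx n)
  choose ε hε hball using hball
  -- Capping the radius by `|x n|` makes the tent vanish at `0`, as the non-unital functional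
  -- calculus requires.
  let r : ℕ → ℝ := fun n => min (ε n) |(x n).1|
  have hr : ∀ n, 0 < r n := fun n => lt_min (hε n) (abs_pos.2 (x n).2.2)
  let φ : ℕ → ℝ → ℝ := fun n t => max (r n - |t - (x n).1|) 0
  have hφ : ∀ n, Continuous (φ n) := fun n => by fun_prop
  have hφ0 : ∀ n, φ n 0 = 0 := fun n => by
    simp only [φ, zero_sub, abs_neg]
    exact max_eq_right (sub_nonpos.2 (min_le_right _ _))
  have hφU : ∀ n (t : X), φ n t ≠ 0 → t ∈ U n := fun n t ht => by
    refine hball n ?_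
    rw [Metric.mem_ball, Subtype.dist_eq, Real.dist_eq]
    by_contra! hlt
    exact ht (max_eq_right (sub_nonpos.2 ((min_le_left _ _).trans hlt)))
  refine ⟨fun n => cfcₙ (φ n) a, fun n => cfcₙ_predicate _ _, fun n h => ?_, fun m n hmn => ?_⟩
  · have h' : cfcₙ (φ n) a = cfcₙ (0 : ℝ → ℝ) a := h.trans (cfcₙ_zero ℝ a).symm
    have heq := (cfcₙ_eq_cfcₙ_iff_eqOn ha (hφ n).continuousOn (hφ0 n)).1 h' (x n).2.1
    simp only [φ, sub_self, abs_zero, sub_zero, Pi.zero_apply] at heq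
    exact (hr n).not_ge (max_eq_right_iff.1 heq)
  · change cfcₙ (φ m) a * cfcₙ (φ n) a = 0
    rw [← cfcₙ_mul (φ m) (φ n) a (hφ m).continuousOn (hφ0 m) (hφ n).continuousOn (hφ0 n),
      ← cfcₙ_zero ℝ a]
    refine cfcₙ_congr fun t ht => ?_
    by_contra hne
    have h0 : t ≠ 0 := fun h0 => hne (by simp [h0, hφ0])
    have h1 := mul_ne_zero_iff.1 (show φ m t * φ n t ≠ 0 from hne)
    exact Set.disjoint_left.1 (hU hmn) (hφU m ⟨t, ht, h0⟩ h1.1) (hφU n ⟨t, ht, h0⟩ h1.2)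

/-- The successive differences are orthogonal. -/
theorem hasOrthogonalSequence_of_antitone_projections {f : ℕ → B}
    (hf : ∀ n, IsStarProjection (f n)) (hle : ∀ n, f (n + 1) * f n = f (n + 1))
    (hne : ∀ n, f (n + 1) ≠ f n) : HasOrthogonalSequence B := by
  have hstar : ∀ n, star (f n) = f n := fun n => (hf n).isSelfAdjoint.star_eq
  have hid : ∀ n, f n * f n = f n := fun n => (hf n).isIdempotentElem
  have hmono : ∀ m n, m ≤ n → f n * f m = f n := by
    intro m n hmn
    induction n, hmn using Nat.le_induction with
    | base => exact hid m
    | succ n _ ih => rw [← hle n, mul_assoc, ih]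
  have hmono' : ∀ m n, m ≤ n → f m * f n = f n := fun m n hmn => by
    simpa [hstar] using congrArg star (hmono m n hmn)
  have hlt : ∀ m n, m < n → (f m - f (m + 1)) * (f n - f (n + 1)) = 0 := fun m n hmn => by
    rw [sub_mul, mul_sub, mul_sub, hmono' m n hmn.le, hmono' m (n + 1) (by omega),
      hmono' (m + 1) n hmn, hmono' (m + 1) (n + 1) (by omega), sub_self]
  have hsa : ∀ n, star (f n - f (n + 1)) = f n - f (n + 1) := fun n => by simp [hstar]
  refine ⟨fun n => f n - f (n + 1), hsa, fun n => sub_ne_zero.2 (hne n).symm, fun m n hmn => ?_⟩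
  rcases hmn.lt_or_gt with h | h
  · exact hlt m n h
  · simpa only [star_mul, hsa, star_zero] using congrArg star (hlt n m h)

theorem hasOrthogonalSequence_of_monotone_projections {f : ℕ → B}
    (hf : ∀ n, IsStarProjection (f n)) (hle : ∀ n, f n * f (n + 1) = f n)
    (hne : ∀ n, f n ≠ f (n + 1)) : HasOrthogonalSequence B := by
  have hstar : ∀ n, star (f n) = f n := fun n => (hf n).isSelfAdjoint.star_eq
  have hid : ∀ n, f n * f n = f n := fun n => (hf n).isIdempotentElem
  have hmono : ∀ m n, m ≤ n → f m * f n = f m := by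
    intro m n hmn
    induction n, hmn using Nat.le_induction with
    | base => exact hid m
    | succ n _ ih => rw [← ih, mul_assoc, hle n]
  have hmono' : ∀ m n, m ≤ n → f n * f m = f m := fun m n hmn => by
    simpa [hstar] using congrArg star (hmono m n hmn)
  have hlt : ∀ m n, m < n → (f (m + 1) - f m) * (f (n + 1) - f n) = 0 := fun m n hmn => by
    rw [sub_mul, mul_sub, mul_sub, hmono m n hmn.le, hmono m (n + 1) (by omega),
      hmono (m + 1) n hmn, hmono (m + 1) (n + 1) (by omega), sub_self, sub_self, sub_self]
  have hsa : ∀ n, star (f (n + 1) - f n) = f (n + 1) - f n := fun n => by simp [hstar]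
  refine ⟨fun n => f (n + 1) - f n, hsa, fun n => sub_ne_zero.2 (hne n).symm, fun m n hmn => ?_⟩
  rcases hmn.lt_or_gt with h | h
  · exact hlt m n h
  · simpa only [star_mul, hsa, star_zero] using congrArg star (hlt n m h)

/-- On a finite spectrum the indicator function of a nonzero point is continuous. -/
theorem exists_spectral_projection {a : B} (ha : IsSelfAdjoint a) (ha0 : a ≠ 0)
    (hfin : (quasispectrum ℝ a).Finite) :
    ∃ (r : ℝ) (q : B), r ≠ 0 ∧ IsStarProjection q ∧ q ≠ 0 ∧ a * q = r • q := by
  have hex : ∃ r ∈ quasispectrum ℝ a, r ≠ 0 := by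
    by_contra! hall
    refine ha0 ?_
    rw [← cfcₙ_id ℝ a, ← cfcₙ_zero ℝ a]
    exact cfcₙ_congr fun t ht => hall t ht
  obtain ⟨r, hr, hr0⟩ := hex
  let χ : ℝ → ℝ := fun t => if t = r then 1 else 0
  have hχ : ContinuousOn χ (quasispectrum ℝ a) := hfin.continuousOn χ
  have hχ0 : χ 0 = 0 := if_neg hr0.symm
  refine ⟨r, cfcₙ χ a, hr0, ⟨?_, cfcₙ_predicate _ _⟩, fun h => ?_, ?_⟩
  · rw [IsIdempotentElem, ← cfcₙ_mul χ χ a hχ hχ0 hχ hχ0]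
    exact cfcₙ_congr fun t _ => by simp [χ]
  · have h' : cfcₙ χ a = cfcₙ (0 : ℝ → ℝ) a := by rw [h]; exact (cfcₙ_zero ℝ a).symm
    have := (cfcₙ_eq_cfcₙ_iff_eqOn ha hχ hχ0).1 h' hr
    simp [χ] at this
  · have h2 : a * cfcₙ χ a = cfcₙ (fun t => t * χ t) a := by
      rw [cfcₙ_mul (fun t => t) χ a continuousOn_id rfl hχ hχ0, cfcₙ_id' ℝ a]
    rw [h2, ← cfcₙ_smul r χ a hχ hχ0]
    refine cfcₙ_congr fun t _ => ?_
    by_cases h : t = r <;> simp [χ, h]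

/-- The elements `x` with `p x = x = x q`. -/
def offCorner (p q : B) : Submodule ℂ B where
  carrier := {x | p * x = x ∧ x * q = x}
  add_mem' {x y} hx hy := ⟨by rw [mul_add, hx.1, hy.1], by rw [add_mul, hx.2, hy.2]⟩
  zero_mem' := by simp
  smul_mem' c x hx := ⟨by rw [mul_smul_comm, hx.1], by rw [smul_mul_assoc, hx.2]⟩

/-- A nonzero projection without proper nonzero subprojections. -/
structure IsMinimalProjection (m : B) : Prop where
  isStarProjection : IsStarProjection m
  ne_zero : m ≠ 0
  eq_of_le : ∀ q : B, IsStarProjection q → q ≠ 0 → q * m = q → q = m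

/-- A spectral projection of `x` lies under `m`, hence equals `m`, so `x` has only one nonzero
spectral value. -/
theorem IsMinimalProjection.exists_eq_real_smul {m : B} (hm : IsMinimalProjection m)
    (hfin : ∀ a : B, IsSelfAdjoint a → (quasispectrum ℝ a).Finite) {x : B} (hx : IsSelfAdjoint x)
    (hxm : m * x = x) : ∃ r : ℝ, x = r • m := by
  by_cases h0 : x = 0
  · exact ⟨0, by simp [h0]⟩
  obtain ⟨r, q, hr, hq, hq0, hxq⟩ := exists_spectral_projection hx h0 (hfin x hx)
  have hmq : m * q = q := by
    have : q = r⁻¹ • (x * q) := by rw [hxq, smul_smul, inv_mul_cancel₀ hr, one_smul]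
    rw [this, mul_smul_comm, ← mul_assoc, hxm]
  have hqm : q * m = q := by
    simpa [hq.isSelfAdjoint.star_eq, hm.isStarProjection.isSelfAdjoint.star_eq] using
      congrArg star hmq
  have hxm' : x * m = x := by
    simpa [hx.star_eq, hm.isStarProjection.isSelfAdjoint.star_eq] using congrArg star hxm
  refine ⟨r, ?_⟩
  rw [← hm.eq_of_le q hq hq0 hqm, ← hxq, hm.eq_of_le q hq hq0 hqm, hxm']

theorem IsMinimalProjection.offCorner_le_span {m : B} (hm : IsMinimalProjection m)
    (hfin : ∀ a : B, IsSelfAdjoint a → (quasispectrum ℝ a).Finite) :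
    offCorner m m ≤ Submodule.span ℂ {m} := by
  intro x hx
  have hms := hm.isStarProjection.isSelfAdjoint.star_eq
  have hx' : m * star x = star x := by simpa [hms] using congrArg star hx.2
  have hre : m * (realPart x : B) = realPart x := by
    rw [realPart_apply_coe, mul_smul_comm, mul_add, hx.1, hx']
  have him : m * (imaginaryPart x : B) = imaginaryPart x := by
    rw [imaginaryPart_apply_coe, mul_smul_comm, mul_smul_comm, mul_sub, hx.1, hx']
  obtain ⟨r, hr⟩ := hm.exists_eq_real_smul hfin (realPart x).2 hre
  obtain ⟨s, hs⟩ := hm.exists_eq_real_smul hfin (imaginaryPart x).2 him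
  rw [← realPart_add_I_smul_imaginaryPart x, hr, hs]
  have hmem : m ∈ Submodule.span ℂ {m} := Submodule.mem_span_singleton_self m
  refine add_mem ?_ (Submodule.smul_mem _ _ ?_)
  · rw [← Complex.coe_smul]; exact Submodule.smul_mem _ _ hmem
  · rw [← Complex.coe_smul]; exact Submodule.smul_mem _ _ hmem

theorem IsMinimalProjection.star_mul_self_eq {m p x : B} (hm : IsMinimalProjection m)
    (hfin : ∀ a : B, IsSelfAdjoint a → (quasispectrum ℝ a).Finite) (hx : x ∈ offCorner p m)
    (hx0 : x ≠ 0) : ∃ r : ℝ, r ≠ 0 ∧ star x * x = r • m := by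
  have hms := hm.isStarProjection.isSelfAdjoint.star_eq
  have hx' : m * star x = star x := by simpa [hms] using congrArg star hx.2
  obtain ⟨r, hr⟩ := hm.exists_eq_real_smul hfin (.star_mul_self x) (by rw [← mul_assoc, hx'])
  refine ⟨r, fun h => hx0 ?_, hr⟩
  rw [h, zero_smul] at hr
  exact (CStarRing.star_mul_self_eq_zero_iff x).1 hr

/-- For a fixed nonzero `x` in `p B m`, the map `y ↦ y x⋆` embeds `p B m` into `p B p`: it is
injective because `y x⋆ x` is a nonzero multiple of `y`. -/
theorem IsMinimalProjection.finiteDimensional_offCorner_right {m p : B}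
    (hm : IsMinimalProjection m) (hp : IsStarProjection p)
    (hfin : ∀ a : B, IsSelfAdjoint a → (quasispectrum ℝ a).Finite)
    (hpp : FiniteDimensional ℂ (offCorner p p)) : FiniteDimensional ℂ (offCorner p m) := by
  by_cases hbot : ∀ x ∈ offCorner p m, x = 0
  · rw [(Submodule.eq_bot_iff _).2 hbot]
    infer_instance
  push Not at hbot
  obtain ⟨x, hx, hx0⟩ := hbot
  obtain ⟨r, hr, hxr⟩ := hm.star_mul_self_eq hfin hx hx0
  have hx' : star x * p = star x := by
    simpa [hp.isSelfAdjoint.star_eq] using congrArg star hx.1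
  let φ : offCorner p m →ₗ[ℂ] offCorner p p :=
    ((LinearMap.mulRight ℂ (star x)).domRestrict (offCorner p m)).codRestrict _ fun y => by
      simp only [LinearMap.domRestrict_apply, LinearMap.mulRight_apply]
      exact ⟨by rw [← mul_assoc, y.2.1], by rw [mul_assoc, hx']⟩
  refine FiniteDimensional.of_injective φ ((injective_iff_map_eq_zero φ).2 fun y hy => ?_)
  have h1 : (y : B) * star x = 0 := congrArg Subtype.val hy
  have h2 : r • (y : B) = 0 := by
    rw [← y.2.2, ← mul_smul_comm, ← hxr, ← mul_assoc, h1, zero_mul]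
  exact Subtype.ext ((smul_eq_zero.1 h2).resolve_left hr)

theorem IsMinimalProjection.finiteDimensional_offCorner_left {m p : B}
    (hm : IsMinimalProjection m) (hp : IsStarProjection p)
    (hfin : ∀ a : B, IsSelfAdjoint a → (quasispectrum ℝ a).Finite)
    (hpp : FiniteDimensional ℂ (offCorner p p)) : FiniteDimensional ℂ (offCorner m p) := by
  have hps := hp.isSelfAdjoint.star_eq
  have hms := hm.isStarProjection.isSelfAdjoint.star_eq
  by_cases hbot : ∀ x ∈ offCorner p m, x = 0
  · have : offCorner m p = ⊥ := (Submodule.eq_bot_iff _).2 fun x hx => by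
      rw [← star_eq_zero]
      refine hbot _ ⟨?_, ?_⟩
      · simpa [hps] using congrArg star hx.2
      · simpa [hms] using congrArg star hx.1
    rw [this]
    infer_instance
  push Not at hbot
  obtain ⟨x, hx, hx0⟩ := hbot
  obtain ⟨r, hr, hxr⟩ := hm.star_mul_self_eq hfin hx hx0
  let φ : offCorner m p →ₗ[ℂ] offCorner p p :=
    ((LinearMap.mulLeft ℂ x).domRestrict (offCorner m p)).codRestrict _ fun y => by
      simp only [LinearMap.domRestrict_apply, LinearMap.mulLeft_apply]
      exact ⟨by rw [← mul_assoc, hx.1], by rw [mul_assoc, y.2.2]⟩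
  refine FiniteDimensional.of_injective φ ((injective_iff_map_eq_zero φ).2 fun y hy => ?_)
  have h1 : x * (y : B) = 0 := congrArg Subtype.val hy
  have h2 : r • (y : B) = 0 := by
    rw [← y.2.1, ← smul_mul_assoc, ← hxr, mul_assoc, h1, mul_zero]
  exact Subtype.ext ((smul_eq_zero.1 h2).resolve_left hr)

theorem isStarProjection_add {p m : B} (hp : IsStarProjection p) (hm : IsStarProjection m)
    (hpm : p * m = 0) : IsStarProjection (p + m) := by
  have hmp : m * p = 0 := by
    simpa [hp.isSelfAdjoint.star_eq, hm.isSelfAdjoint.star_eq] using congrArg star hpm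
  refine ⟨?_, hp.isSelfAdjoint.add hm.isSelfAdjoint⟩
  rw [IsIdempotentElem, mul_add, add_mul, add_mul, hp.isIdempotentElem.eq, hm.isIdempotentElem.eq,
    hpm, hmp, add_zero, zero_add]

/-- Peirce decomposition into four corners. -/
theorem IsMinimalProjection.finiteDimensional_offCorner_add {m p : B}
    (hm : IsMinimalProjection m) (hp : IsStarProjection p)
    (hfin : ∀ a : B, IsSelfAdjoint a → (quasispectrum ℝ a).Finite)
    (hpp : FiniteDimensional ℂ (offCorner p p)) :
    FiniteDimensional ℂ (offCorner (p + m) (p + m)) := by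
  have h1 := hm.finiteDimensional_offCorner_right hp hfin hpp
  have h2 := hm.finiteDimensional_offCorner_left hp hfin hpp
  have h3 : FiniteDimensional ℂ (offCorner m m) :=
    Submodule.finiteDimensional_of_le (hm.offCorner_le_span hfin)
  have hid := hp.isIdempotentElem.eq
  have hid' := hm.isStarProjection.isIdempotentElem.eq
  have hmem : ∀ p q x : B, p * p = p → q * q = q → p * x * q ∈ offCorner p q :=
    fun p q x hp hq => ⟨by simp only [← mul_assoc, hp], by rw [mul_assoc, hq]⟩
  refine Submodule.finiteDimensional_of_le
    (S₂ := (offCorner p p ⊔ offCorner p m) ⊔ (offCorner m p ⊔ offCorner m m)) fun x hx => ?_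
  have hdec : x = (p * x * p + p * x * m) + (m * x * p + m * x * m) := by
    conv_lhs => rw [← hx.2, ← hx.1]
    simp only [add_mul, mul_add]
    abel
  rw [hdec]
  exact Submodule.add_mem_sup (Submodule.add_mem_sup (hmem _ _ _ hid hid) (hmem _ _ _ hid hid'))
    (Submodule.add_mem_sup (hmem _ _ _ hid' hid) (hmem _ _ _ hid' hid'))

/-- A strictly descending sequence of projections would give an orthogonal sequence, so the order on
projections is well founded. -/
theorem exists_isMinimalProjection_le (hB : ¬ HasOrthogonalSequence B) {q : B}
    (hq : IsStarProjection q) (hq0 : q ≠ 0) : ∃ m : B, IsMinimalProjection m ∧ q * m = m := by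
  let r : {p : B // IsStarProjection p} → {p : B // IsStarProjection p} → Prop :=
    fun s t => s.1 * t.1 = s.1 ∧ s.1 ≠ t.1
  have hwf : WellFounded r := wellFounded_iff_isEmpty_descending_chain.2
    ⟨fun f => hB (hasOrthogonalSequence_of_antitone_projections (fun n => (f.1 n).2)
      (fun n => (f.2 n).1) (fun n => (f.2 n).2))⟩
  obtain ⟨m, ⟨hm0, hqm⟩, hmin⟩ := hwf.has_min {p | p.1 ≠ 0 ∧ p.1 * q = p.1}
    ⟨⟨q, hq⟩, hq0, hq.isIdempotentElem⟩
  refine ⟨m.1, ⟨m.2, hm0, fun s hs hs0 hsm => ?_⟩, ?_⟩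
  · by_contra hne
    have hsq : s * q = s := by rw [← hsm, mul_assoc, hqm]
    exact hmin ⟨s, hs⟩ ⟨hs0, hsq⟩ ⟨hsm, hne⟩
  · simpa [hq.isSelfAdjoint.star_eq, m.2.isSelfAdjoint.star_eq] using congrArg star hqm

/-- An infinite-dimensional C⋆-algebra contains infinitely many pairwise orthogonal nonzero
self-adjoint elements. -/
theorem hasOrthogonalSequence_of_not_finiteDimensional (hdim : ¬ FiniteDimensional ℂ B) :
    HasOrthogonalSequence B := by
  by_contra hB
  have hfin : ∀ a : B, IsSelfAdjoint a → (quasispectrum ℝ a).Finite := fun a ha => by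
    by_contra hinf
    exact hB (hasOrthogonalSequence_of_infinite_quasispectrum ha hinf)
  -- The order is reversed, so that a minimal element for `r` is a maximal projection with
  -- finite-dimensional corner.
  let r : {p : B // IsStarProjection p} → {p : B // IsStarProjection p} → Prop :=
    fun s t => t.1 * s.1 = t.1 ∧ t.1 ≠ s.1
  have hwf : WellFounded r := wellFounded_iff_isEmpty_descending_chain.2
    ⟨fun f => hB (hasOrthogonalSequence_of_monotone_projections (fun n => (f.1 n).2)
      (fun n => (f.2 n).1) (fun n => (f.2 n).2))⟩
  obtain ⟨p, hpfin, hmax⟩ := hwf.has_min {p | FiniteDimensional ℂ (offCorner p.1 p.1)} <| by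
    refine ⟨⟨0, .zero _⟩, ?_⟩
    have : offCorner (0 : B) 0 = ⊥ :=
      (Submodule.eq_bot_iff _).2 fun x hx => by rw [← hx.1, zero_mul]
    rw [Set.mem_ofPred_eq, this]
    infer_instance
  obtain ⟨p, hp⟩ := p
  have hps := hp.isSelfAdjoint.star_eq
  -- The maximal `p` is a unit for `B`: otherwise some nonzero `d d⋆` is orthogonal to `p`, a
  -- minimal projection `m` lies under one of its spectral projections, and `p + m` contradicts
  -- maximality.
  have hunit : ∀ y, p * y = y := by
    intro y
    by_contra hy
    set d := y - p * y with hd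
    have hd0 : d ≠ 0 := sub_ne_zero.2 (Ne.symm hy)
    have hpd : p * d = 0 := by
      rw [hd, mul_sub, ← mul_assoc, hp.isIdempotentElem.eq, sub_self]
    have hx0 : d * star d ≠ 0 := (CStarRing.mul_star_self_ne_zero_iff d).2 hd0
    have hxsa : IsSelfAdjoint (d * star d) := .mul_star_self d
    obtain ⟨s, q, hs, hq, hq0, hxq⟩ := exists_spectral_projection hxsa hx0 (hfin _ hxsa)
    obtain ⟨m, hm, hqm⟩ := exists_isMinimalProjection_le hB hq hq0
    have hpq : p * q = 0 := by
      have : q = s⁻¹ • (d * star d * q) := by rw [hxq, smul_smul, inv_mul_cancel₀ hs, one_smul]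
      rw [this, mul_smul_comm, mul_assoc, ← mul_assoc, hpd, zero_mul, smul_zero]
    have hpm : p * m = 0 := by rw [← hqm, ← mul_assoc, hpq, zero_mul]
    refine hmax ⟨p + m, isStarProjection_add hp hm.isStarProjection hpm⟩
      (hm.finiteDimensional_offCorner_add hp hfin hpfin) ⟨?_, ?_⟩
    · change p * (p + m) = p
      rw [mul_add, hpm, hp.isIdempotentElem.eq, add_zero]
    · change p ≠ p + m
      simpa using hm.ne_zero
  have hunit' : ∀ y, y * p = y := fun y => by
    simpa [hps] using congrArg star (hunit (star y))
  have htop : offCorner p p = ⊤ := eq_top_iff.2 fun y _ => ⟨hunit y, hunit' y⟩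
  have hpfin' : FiniteDimensional ℂ (offCorner p p) := hpfin
  rw [htop] at hpfin'
  exact hdim (Submodule.topEquiv.finiteDimensional)

theorem HasOrthogonalSequence.exists_norm_eq_one (h : HasOrthogonalSequence B) :
    ∃ b : ℕ → B, (∀ n, IsSelfAdjoint (b n)) ∧ (∀ n, ‖b n‖ = 1) ∧
      Pairwise fun m n => b m * b n = 0 := by
  obtain ⟨b, hsa, hne, horth⟩ := h
  refine ⟨fun n => ‖b n‖⁻¹ • b n, fun n => IsSelfAdjoint.smul (.all _) (hsa n), fun n => ?_,
    fun m n hmn => ?_⟩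
  · rw [norm_smul, norm_inv, norm_norm, inv_mul_cancel₀ (norm_ne_zero_iff.2 (hne n))]
  · change _ * _ = _
    rw [smul_mul_smul_comm, horth hmn, smul_zero]

end OrthogonalSequence

/-! ### Separation of orthogonal elements in the Calkin algebra -/

section Calkin

variable {H : Type*} [NormedAddCommGroup H] [InnerProductSpace ℂ H] [CompleteSpace H]

/-- Orthogonal positive elements `s`, `t` admit an element acting on the left as a unit on `s` and
as zero on `t`. -/
def SeparatesOrthogonal (A : Type*) [NonUnitalCStarAlgebra A] : Prop :=
  ∀ x y : A, (star x * x) * (star y * y) = 0 →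
    ∃ e : A, e * (star x * x) = star x * x ∧ e * (star y * y) = 0

/-- Project onto the closed range of `S`: the range of `T` lies in `ker S`, which is the orthogonal
complement of that range. -/
theorem exists_mul_eq_self_mul_eq_zero {S T : H →L[ℂ] H} (hS : IsSelfAdjoint S) (hST : S * T = 0) :
    ∃ e : H →L[ℂ] H, e * S = S ∧ e * T = 0 := by
  let U : Submodule ℂ H := (LinearMap.range (S : H →ₗ[ℂ] H)).topologicalClosure
  have : CompleteSpace U := (Submodule.isClosed_topologicalClosure _).completeSpace_coe
  refine ⟨U.starProjection, ?_, ?_⟩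
  · ext v
    exact Submodule.starProjection_eq_self_iff.2 (Submodule.le_topologicalClosure _ ⟨v, rfl⟩)
  · ext v
    refine (Submodule.starProjection_apply_eq_zero_iff U).2 ?_
    rw [Submodule.orthogonal_closure]
    rintro _ ⟨w, rfl⟩
    have h1 : S (T v) = 0 := congrArg (fun R : H →L[ℂ] H => R v) hST
    have h2 := ContinuousLinearMap.adjoint_inner_left S (T v) w
    rw [← ContinuousLinearMap.star_eq_adjoint, hS.star_eq, h1, inner_zero_right] at h2
    exact h2

/-- Orthogonal positive elements are the positive and negative parts of their difference. Lifting
the difference to a self-adjoint `T`, uniqueness of these parts makes `T⁺` and `T⁻` orthogonal lifts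
of the two elements. -/
theorem separatesOrthogonal_calkinAlgebra : SeparatesOrthogonal (CalkinAlgebra H) := by
  intro x y hxy
  let _ := CStarAlgebra.spectralOrder (CalkinAlgebra H)
  have := CStarAlgebra.spectralOrderedRing (CalkinAlgebra H)
  let _ := CStarAlgebra.spectralOrder (H →L[ℂ] H)
  have := CStarAlgebra.spectralOrderedRing (H →L[ℂ] H)
  obtain ⟨X, rfl⟩ := CalkinAlgebra.mk_surjective x
  obtain ⟨Y, rfl⟩ := CalkinAlgebra.mk_surjective y
  set T : H →L[ℂ] H := star X * X - star Y * Y with hT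
  have hTsa : IsSelfAdjoint T := .sub (.star_mul_self X) (.star_mul_self Y)
  have hmk : ∀ R : H →L[ℂ] H, 0 ≤ R → 0 ≤ CalkinAlgebra.mk R := fun R hR => by
    obtain ⟨Z, rfl⟩ := CStarAlgebra.nonneg_iff_eq_star_mul_self.1 hR
    rw [map_mul, CalkinAlgebra.mk_star]
    exact star_mul_self_nonneg _
  have h1 := CFC.posPart_negPart_unique (a := CalkinAlgebra.mk T)
    (b := star (CalkinAlgebra.mk X) * CalkinAlgebra.mk X)
    (c := star (CalkinAlgebra.mk Y) * CalkinAlgebra.mk Y)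
    (by simp only [hT, map_sub, map_mul, CalkinAlgebra.mk_star]) hxy
    (star_mul_self_nonneg _) (star_mul_self_nonneg _)
  have h2 := CFC.posPart_negPart_unique (a := CalkinAlgebra.mk T)
    (b := CalkinAlgebra.mk T⁺) (c := CalkinAlgebra.mk T⁻)
    (by rw [← map_sub, CFC.posPart_sub_negPart T hTsa])
    (by rw [← map_mul, CFC.posPart_mul_negPart, map_zero])
    (hmk _ (CFC.posPart_nonneg T)) (hmk _ (CFC.negPart_nonneg T))
  obtain ⟨e, he, he'⟩ := exists_mul_eq_self_mul_eq_zero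
    (IsSelfAdjoint.of_nonneg (CFC.posPart_nonneg T)) (CFC.posPart_mul_negPart T)
  refine ⟨CalkinAlgebra.mk e, ?_, ?_⟩
  · rw [← h1.1, h2.1, ← map_mul, he]
  · rw [← h1.2, h2.2, ← map_mul, he', map_zero]

theorem SeparatesOrthogonal.of_starAlgEquiv {A A' : Type*} [NonUnitalCStarAlgebra A]
    [NonUnitalCStarAlgebra A'] (h : SeparatesOrthogonal A) (Φ : A ≃⋆ₐ[ℂ] A') :
    SeparatesOrthogonal A' := by
  intro x y hxy
  obtain ⟨e, h1, h2⟩ := h (Φ.symm x) (Φ.symm y) (by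
    simp only [← map_star, ← map_mul]
    rw [hxy, map_zero])
  refine ⟨Φ e, ?_, ?_⟩
  · simpa [map_star] using congrArg Φ h1
  · simpa [map_star] using congrArg Φ h2

/-- Countably many orthogonal positive contractions can be separated into any two classes. -/
theorem SeparatesOrthogonal.exists_mul_mul_self_eq {A : Type*} [NonUnitalCStarAlgebra A]
    (hA : SeparatesOrthogonal A) {ι : Type*} [Encodable ι] {u : ι → A}
    (hu : ∀ i, ∃ x, u i = star x * x) (hu1 : ∀ i, ‖u i‖ ≤ 1)
    (horth : Pairwise fun i k => u i * u k = 0) (D : Set ι) :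
    ∃ e : A, (∀ i ∈ D, e * (u i * u i) = u i * u i) ∧ ∀ i ∉ D, e * (u i * u i) = 0 := by
  classical
  let _ := CStarAlgebra.spectralOrder A
  have := CStarAlgebra.spectralOrderedRing A
  have hu0 : ∀ i, 0 ≤ u i := fun i => by
    obtain ⟨x, hx⟩ := hu i
    rw [hx]
    exact star_mul_self_nonneg x
  -- Summable weights combine each class into one positive element; the two sums are orthogonal.
  let c : ι → ℝ := fun i => (1 / 2 : ℝ) ^ Encodable.encode i
  have hc : ∀ i, 0 < c i := fun i => by positivity
  have hcs : Summable c := summable_geometric_two.comp_injective Encodable.encode_injective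
  let v : Set ι → ι → A := fun E i => if i ∈ E then c i • u i else 0
  have hv0 : ∀ E i, 0 ≤ v E i := fun E i => by
    by_cases h : i ∈ E
    · simpa [v, h] using smul_nonneg (hc i).le (hu0 i)
    · simp [v, h]
  have hvs : ∀ E, Summable (v E) := fun E => by
    refine Summable.of_norm_bounded hcs fun i => ?_
    by_cases h : i ∈ E
    · simp only [v, h, if_true, norm_smul, Real.norm_of_nonneg (hc i).le]
      exact mul_le_of_le_one_right (hc i).le (hu1 i)
    · simpa [v, h] using (hc i).le
  have hvu : ∀ E i k, i ≠ k → v E k * u i = 0 := fun E i k hik => by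
    by_cases h : k ∈ E
    · simp only [v, h, if_true, smul_mul_assoc, horth hik.symm, smul_zero]
    · simp [v, h]
  have hmul : ∀ E i, (∑' k, v E k) * u i = v E i * u i := fun E i => by
    rw [← (hvs E).tsum_mul_right, tsum_eq_single i fun k hk => hvu E i k hk.symm]
  have hpos : ∀ E, ∃ x, (∑' k, v E k) = star x * x := fun E =>
    CStarAlgebra.nonneg_iff_eq_star_mul_self.1 (tsum_nonneg (hv0 E))
  obtain ⟨x, hx⟩ := hpos D
  obtain ⟨y, hy⟩ := hpos Dᶜ
  have hxy : (star x * x) * (star y * y) = 0 := by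
    rw [← hx, ← hy, ← (hvs Dᶜ).tsum_mul_left]
    refine (tsum_congr fun i => ?_).trans tsum_zero
    by_cases h : i ∈ D
    · simp [v, h]
    · simp only [v, Set.mem_compl_iff, h, not_false_eq_true, if_true, mul_smul_comm]
      have := hmul D i
      simp only [v, h, if_false, zero_mul] at this
      rw [this, smul_zero]
  obtain ⟨e, he, he'⟩ := hA x y hxy
  rw [← hx] at he
  rw [← hy] at he'
  refine ⟨e, fun i hi => ?_, fun i hi => ?_⟩
  -- Only the product of `e` with the whole sum is known; multiplying by `u i` on the right isolates
  -- one term and leaves its square.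
  · have h1 : c i • (u i * u i) = (∑' k, v D k) * u i := by
      rw [hmul]; simp only [v, hi, if_true, smul_mul_assoc]
    have h2 : c i • (e * (u i * u i)) = c i • (u i * u i) := by
      rw [← mul_smul_comm, h1, ← mul_assoc, he]
    exact smul_right_injective A (hc i).ne' h2
  · have h1 : c i • (u i * u i) = (∑' k, v Dᶜ k) * u i := by
      rw [hmul]; simp only [v, Set.mem_compl_iff, hi, not_false_eq_true, if_true, smul_mul_assoc]
    have h2 : c i • (e * (u i * u i)) = 0 := by
      rw [← mul_smul_comm, h1, ← mul_assoc, he', zero_mul]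
    exact (smul_eq_zero.1 h2).resolve_left (hc i).ne'

end Calkin

/-! ### The compactness contradiction -/

section Main

theorem not_separatesOrthogonal {B : Type v} {C : Type w} {A : Type*} [NonUnitalCStarAlgebra B]
    [NonUnitalCStarAlgebra C] [NonUnitalCStarAlgebra A] (hB : ¬ FiniteDimensional ℂ B)
    (hC : ¬ FiniteDimensional ℂ C) (j : B ⊗[ℂ] C →⋆ₙₐ[ℂ] A) (hj : Function.Injective j)
    (hd : DenseRange j) : ¬ SeparatesOrthogonal A := by
  intro hA
  obtain ⟨b, hbsa, hb1, hb⟩ :=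
    (hasOrthogonalSequence_of_not_finiteDimensional hB).exists_norm_eq_one
  obtain ⟨c, hcsa, hc1, hc⟩ :=
    (hasOrthogonalSequence_of_not_finiteDimensional hC).exists_norm_eq_one
  let q : ℕ → B := fun n => b n * b n
  let s : ℕ → C := fun n => c n * c n
  have hqsa : ∀ n, star (q n) = q n := fun n => by simp [q, (hbsa n).star_eq]
  have hssa : ∀ n, star (s n) = s n := fun n => by simp [s, (hcsa n).star_eq]
  have hq1 : ∀ n, ‖q n‖ = 1 := fun n => by
    have := CStarRing.norm_star_mul_self (x := b n)
    rwa [(hbsa n).star_eq, hb1, one_mul] at this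
  have hs1 : ∀ n, ‖s n‖ = 1 := fun n => by
    have := CStarRing.norm_star_mul_self (x := c n)
    rwa [(hcsa n).star_eq, hc1, one_mul] at this
  have hqq1 : ∀ n, ‖q n * q n‖ = 1 := fun n => by
    have := CStarRing.norm_star_mul_self (x := q n)
    rwa [hqsa, hq1, one_mul] at this
  have hss1 : ∀ n, ‖s n * s n‖ = 1 := fun n => by
    have := CStarRing.norm_star_mul_self (x := s n)
    rwa [hssa, hs1, one_mul] at this
  have hqorth : ∀ m n, m ≠ n → q m * q n = 0 := fun m n hmn => by
    simp only [q, mul_assoc]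
    rw [← mul_assoc (b m) (b n), hb hmn, zero_mul, mul_zero]
  have hsorth : ∀ m n, m ≠ n → s m * s n = 0 := fun m n hmn => by
    simp only [s, mul_assoc]
    rw [← mul_assoc (c m) (c n), hc hmn, zero_mul, mul_zero]
  -- The separated classes are the diagonal and the off-diagonal of the grid; squaring `b` and `c`
  -- made its entries positive.
  obtain ⟨e, he, he'⟩ := hA.exists_mul_mul_self_eq (ι := ℕ × ℕ)
    (u := fun i => j (q i.1 ⊗ₜ s i.2)) (fun i => ⟨j (b i.1 ⊗ₜ c i.2), by
      rw [map_tmul_star, map_tmul_mul_tmul, (hbsa _).star_eq, (hcsa _).star_eq]⟩)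
    (fun i => by rw [norm_map_tmul j hj, hq1, hs1, one_mul])
    (fun i k hik => by
      change j _ * j _ = 0
      rw [map_tmul_mul_tmul]
      by_cases h : i.1 = k.1
      · rw [hsorth _ _ fun h' => hik (Prod.ext h h'), TensorProduct.tmul_zero, map_zero]
      · rw [hqorth _ _ h, TensorProduct.zero_tmul, map_zero])
    {i | i.1 = i.2}
  simp only [map_tmul_mul_tmul, Prod.forall] at he he'
  obtain ⟨_, hz, ⟨z, rfl⟩⟩ := Metric.dense_iff.1 hd e (1 / 8) (by norm_num)
  obtain ⟨K, hK, HK⟩ := isExcised hj z (1 / 8) (by norm_num)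
  have hss0 : ∀ m, s m * s m ≠ 0 := fun m => norm_ne_zero_iff.1 (by rw [hss1]; exact one_ne_zero)
  -- Excision inside `s m² C`, with one compact set `K` for all columns `m`.
  choose t ht k hk H using fun m => HK (s m * s m) (hss0 m)
  -- With `y = s m² t m`, the choice `w = y⋆ / ‖y y⋆‖` normalizes `x m = y w` without using a unit.
  let w : ℕ → C := fun m =>
    ‖s m * s m * t m * star (s m * s m * t m)‖⁻¹ • star (s m * s m * t m)
  let x : ℕ → C := fun m => s m * s m * t m * w m
  -- The fourth power lets `q n² ⊗ s m²` be split off on the left of `p n ⊗ x m`, where `e` acts as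
  -- `1` or `0`.
  let p : ℕ → B := fun n => q n * q n * (q n * q n)
  have hx1 : ∀ m, ‖x m‖ = 1 := fun m => by
    have h0 : s m * s m * t m * star (s m * s m * t m) ≠ 0 :=
      (CStarRing.mul_star_self_ne_zero_iff _).2 (ht m)
    simp only [x, w]
    rw [mul_smul_comm, norm_smul, norm_inv, norm_norm, inv_mul_cancel₀ (norm_ne_zero_iff.2 h0)]
  have hp1 : ∀ n, ‖p n‖ = 1 := fun n => by
    have h1 := CStarRing.norm_star_mul_self (x := q n * q n)
    rwa [star_mul, hqsa, hqq1, one_mul] at h1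
  have hY1 : ∀ n m, ‖j (p n ⊗ₜ x m)‖ = 1 := fun n m => by
    rw [norm_map_tmul j hj, hp1, hx1, one_mul]
  have hYdec : ∀ n m, j (p n ⊗ₜ x m) =
      j ((q n * q n) ⊗ₜ (s m * s m)) * j ((q n * q n) ⊗ₜ (t m * w m)) := fun n m => by
    rw [map_tmul_mul_tmul]
    simp only [p, x, mul_assoc]
  have hclose : ∀ n m, ‖star (j (p n ⊗ₜ x m)) * e * j (p n ⊗ₜ x m) -
      j ((star (p n) * k m * p n) ⊗ₜ (star (x m) * x m))‖ ≤ 1 / 4 := fun n m => by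
    have h1 := H m (p n) (w m)
    change ‖star (j (p n ⊗ₜ x m)) * j z * j (p n ⊗ₜ x m) -
      j ((star (p n) * k m * p n) ⊗ₜ (star (x m) * x m))‖ ≤ 1 / 8 * (‖p n‖ ^ 2 * ‖x m‖ ^ 2) at h1
    rw [hp1, hx1] at h1
    have h2 : ‖star (j (p n ⊗ₜ x m)) * (e - j z) * j (p n ⊗ₜ x m)‖ ≤ 1 / 8 := by
      refine (norm_mul_le _ _).trans ?_
      rw [hY1, mul_one]
      refine (norm_mul_le _ _).trans ?_
      rw [norm_star, hY1, one_mul, ← dist_eq_norm, dist_comm]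
      exact (Metric.mem_ball.1 hz).le
    have h3 : star (j (p n ⊗ₜ x m)) * e * j (p n ⊗ₜ x m) -
        j ((star (p n) * k m * p n) ⊗ₜ (star (x m) * x m)) =
        star (j (p n ⊗ₜ x m)) * (e - j z) * j (p n ⊗ₜ x m) +
        (star (j (p n ⊗ₜ x m)) * j z * j (p n ⊗ₜ x m) -
          j ((star (p n) * k m * p n) ⊗ₜ (star (x m) * x m))) := by
      rw [mul_sub, sub_mul]; abel
    rw [h3]
    exact (norm_add_le _ _).trans (by linarith)
  have hxx1 : ∀ m, ‖star (x m) * x m‖ = 1 := fun m => by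
    rw [CStarRing.norm_star_mul_self, hx1, one_mul]
  have hdiag : ∀ m, ‖star (p m) * p m - star (p m) * k m * p m‖ ≤ 1 / 4 := fun m => by
    have h1 := hclose m m
    have h2 : e * j (p m ⊗ₜ x m) = j (p m ⊗ₜ x m) := by
      rw [hYdec, ← mul_assoc, he m m rfl]
    rwa [mul_assoc, h2, map_tmul_star, map_tmul_mul_tmul, ← map_sub, ← TensorProduct.sub_tmul,
      norm_map_tmul j hj, hxx1, mul_one] at h1
  have hoff : ∀ n m, n ≠ m → ‖star (p n) * k m * p n‖ ≤ 1 / 4 := fun n m hnm => by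
    have h1 := hclose n m
    have h2 : e * j (p n ⊗ₜ x m) = 0 := by
      rw [hYdec, ← mul_assoc, he' n m hnm, zero_mul]
    rwa [mul_assoc, h2, mul_zero, zero_sub, norm_neg, norm_map_tmul j hj, hxx1, mul_one] at h1
  -- By compactness two distinct indices `n`, `m` have `‖k n - k m‖ < 1/4`. Then `p n⋆ p n`, of norm
  -- `1`, is a sum of three terms of norm at most `1/4`: the diagonal error, the difference and the
  -- off-diagonal value.
  obtain ⟨_, -, φ, hφ, hlim⟩ := hK.tendsto_subseq hk
  obtain ⟨N, hN⟩ := Metric.cauchySeq_iff.1 hlim.cauchySeq (1 / 4) (by norm_num)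
  have hdist := hN N le_rfl (N + 1) (by omega)
  have hne : φ N ≠ φ (N + 1) := (hφ (Nat.lt_succ_self N)).ne
  simp only [Function.comp_apply, dist_eq_norm] at hdist
  set n := φ N
  set m := φ (N + 1)
  have h1 : ‖star (p n) * (k n - k m) * p n‖ ≤ 1 / 4 := by
    refine (norm_mul_le _ _).trans ?_
    rw [hp1, mul_one]
    refine (norm_mul_le _ _).trans ?_
    rw [norm_star, hp1, one_mul]
    exact hdist.le
  have h2 : star (p n) * p n = (star (p n) * p n - star (p n) * k n * p n) +
      (star (p n) * (k n - k m) * p n + star (p n) * k m * p n) := by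
    rw [mul_sub, sub_mul]; abel
  have h3 : ‖star (p n) * p n‖ = 1 := by rw [CStarRing.norm_star_mul_self, hp1, one_mul]
  have h4 := norm_add₃_le (a := star (p n) * p n - star (p n) * k n * p n)
    (b := star (p n) * (k n - k m) * p n) (c := star (p n) * k m * p n)
  rw [add_assoc, ← h2, h3] at h4
  linarith [hdiag n, hoff n m hne]

/-- The canonical ⋆-homomorphism of `B ⊙ C` into `B ⊗_ν C`. -/
noncomputable def CStarTensorProduct.ofHom {B : Type v} {C : Type w} [NonUnitalCStarAlgebra B]
    [NonUnitalCStarAlgebra C] (ν : CStarNorm (B ⊗[ℂ] C)) :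
    B ⊗[ℂ] C →⋆ₙₐ[ℂ] CStarTensorProduct ν where
  toFun z := CStarCompletion.of (A := WithCStarNorm ν) z
  map_smul' c z := CStarCompletion.of_smul (A := WithCStarNorm ν) c z
  map_zero' := CStarCompletion.of_zero
  map_add' := CStarCompletion.of_add (A := WithCStarNorm ν)
  map_mul' := CStarCompletion.of_mul (A := WithCStarNorm ν)
  map_star' := CStarCompletion.of_star (A := WithCStarNorm ν)

theorem CStarTensorProduct.ofHom_injective {B : Type v} {C : Type w} [NonUnitalCStarAlgebra B]
    [NonUnitalCStarAlgebra C] (ν : CStarNorm (B ⊗[ℂ] C)) :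
    Function.Injective (CStarTensorProduct.ofHom ν) := by
  refine (injective_iff_map_eq_zero _).2 fun z hz => ν.eq_zero_of_map_eq_zero' z ?_
  have h := CStarCompletion.norm_of (A := WithCStarNorm ν) z
  have hz' : CStarCompletion.of (A := WithCStarNorm ν) z = 0 := hz
  rw [hz', norm_zero] at h
  exact h.symm

end Main

theorem mainTheorem2 (H : Type u) [NormedAddCommGroup H] [InnerProductSpace ℂ H]
    [CompleteSpace H] [TopologicalSpace.SeparableSpace H] :
    EssentiallyNonFactorizable.{u, v, w} (CalkinAlgebra H) := by
  intro B C _ _ hB hC ν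
  refine ⟨fun Φ => not_separatesOrthogonal hB hC (CStarTensorProduct.ofHom ν)
    (CStarTensorProduct.ofHom_injective ν) ?_
    (separatesOrthogonal_calkinAlgebra.of_starAlgEquiv Φ)⟩
  exact (CStarCompletion.isDenseInducing_of (A := WithCStarNorm ν)).dense
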